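/- **Setting.** Let $x_1,\dots,x_n\in\mathbb{R}^p$, $d_1,\dots,d_n\in\{0,1\}$, let $\sigma^2(x_i,d_i)>0$ be known, and let $w_1,\dots,w_n$ be known real weights with $\sum_i w_i=1$. One observes $y=(y_1,\dots,y_n)$, whose law $P_f$ (expectation $E_f$) is that of independent $y_i\sim N(f(x_i,d_i),\sigma^2(x_i,d_i))$, where $f:\mathbb{R}^p\times\{0,1\}\to\mathbb{R}$ lies in a known class $\mathcal{F}$. The parameter is $Lf=\sum_i w_i\,(f(x_i,1)-f(x_i,0))$. Write $\|f\|_\sigma^2=\sum_i f(x_i,d_i)^2/\sigma^2(x_i,d_i)$. Fix $\alpha\in(0,1)$. A (jointly measurable) random set $\mathcal{C}=\mathcal{C}(y)\subseteq\mathbb{R}$ is a $1-\alpha$ confidence set if $\inf_{f\in\mathcal{F}}P_f(Lf\in\mathcal{C})\ge 1-\alpha$. For a one-sided interval $[\hat c,\infty)$ let $q_\beta(\hat c,\{g\})$ be the $\beta$-quantile of $Lg-\hat c$ under $P_g$. The modulus is $$\omega(\delta)=\sup\{Lg-Lf:\ f,g\in\mathcal{F},\ \|f-g\|_\sigma\le\delta\},$$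 and $\omega'(\delta)$ denotes an arbitrary element of the superdifferential of $\omega$ on $[0,\infty)$ at $\delta>0$. $\Phi,\phi,z_p$ are the standard normal cdf, density and $p$-quantile, and $\mathrm{cv}_\alpha(b)$ is the $1-\alpha$ quantile of $|N(b,1)|$. If $(f,g)=(-f^*_\delta,f^*_\delta)$ attains the supremum $\omega(\delta)$, let $\hat L_\delta=a+\sum_i k_i y_i$ with $$k_i=\frac{\omega'(\delta)}{\delta}\,\frac{g(x_i,d_i)-f(x_i,d_i)}{\sigma^2(x_i,d_i)},\qquad a=\tfrac12\Big[L(f+g)-\sum_i k_i\,(f+g)(x_i,d_i)\Big],$$ $\mathrm{sd}(\hat L_\delta)^2=\sum_i k_i^2\sigma^2(x_i,d_i)$, $\overline{\mathrm{bias}}(\hat L_\delta)=\sup_{f\in\mathcal{F}}E_f(\hat L_\delta-Lf)$, $\underline{\mathrm{bias}}(\hat L_\delta)=\inf_{f\in\mathcal{F}}E_f(\hat L_\delta-Lf)$. Put $\hat c^*_\delta=\hat L_\delta-\overline{\mathrm{bias}}(\hat L_\delta)-z_{1-\alpha}\,\mathrm{sd}(\hat L_\delta)$. The fixed-length confidence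 interval (FLCI) around $\hat L_\delta$ is $\hat L_\delta\pm \mathrm{cv}_\alpha(b/\mathrm{sd}(\hat L_\delta))\,\mathrm{sd}(\hat L_\delta)$ with $b=\max\{|\overline{\mathrm{bias}}(\hat L_\delta)|,|\underline{\mathrm{bias}}(\hat L_\delta)|\}$. **Theorem.** Let $\mathcal{F}$ be convex and centrosymmetric ($f\in\mathcal{F}\Rightarrow -f\in\mathcal{F}$), and let $g\in\mathcal{F}$ be such that $f-g\in\mathcal{F}$ for all $f\in\mathcal{F}$. (i) Suppose that $L$ is not identically zero on $\mathcal{F}$. Let $\beta\in(0,1)$ with $\delta=z_\beta+z_{1-\alpha}>0$, and suppose that $-f^*_\delta,f^*_\delta$ attain the supremum $\omega(\delta)$ with $\|2f^*_\delta\|_\sigma=\delta$. Then $$\frac{\inf\{q_\beta(\hat c,\{g\}):\ [\hat c,\infty)\text{ is a }1-\alpha\text{ confidence set}\}}{q_\beta(\hat c^*_\delta,\{g\})}=\frac{\omega(2\delta)}{\omega(\delta)+\delta\,\omega'(\delta)}\ \ge\ \frac12 .$$ (ii) Suppose that $\omega(\delta)<\infty$ for all $\delta>0$ and that for every $L_0\in\mathbb{R}$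 the minimum of $\|f-g\|_\sigma$ over $f\in\mathcal{F}$ with $Lf=L_0$ is attained. For each $\delta>0$ fix an element $\omega'(\delta)$ of the superdifferential and put $\ell(\delta)=2\,\mathrm{cv}_\alpha\!\big(\tfrac{\omega(\delta)}{2\omega'(\delta)}-\tfrac{\delta}{2}\big)\,\omega'(\delta)$. Let $\lambda$ be Lebesgue measure, $Z\sim N(0,1)$, $\tilde z_\alpha=z_{1-\alpha}-z_{1-\alpha/2}$. Then, with the infimum over $\mathcal{C}$ taken over all $1-\alpha$ confidence sets (this infimum is finite), $$\frac{\inf_{\mathcal{C}}E_g\lambda(\mathcal{C})}{\inf_{\delta>0}\ell(\delta)}=\frac{(1-\alpha)\,E[\omega(2(z_{1-\alpha}-Z))\mid Z\le z_{1-\alpha}]}{\inf_{\delta>0}\ell(\delta)}\ \ge\ \frac{z_{1-\alpha}(1-\alpha)-\tilde z_\alpha\Phi(\tilde z_\alpha)+\phi(z_{1-\alpha})-\phi(\tilde z_\alpha)}{z_{1-\alpha/2}} .$$ If $\delta_\chi>0$ minimizes $\ell$ over $(0,\infty)$, then $\inf_{\delta>0}\ell(\delta)$ in the middle term can be replaced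 by $\ell(\delta_\chi)$; and if moreover $-f^*_{\delta_\chi},f^*_{\delta_\chi}$ attain $\omega(\delta_\chi)$, then the efficiency at $g$ of the FLCI around $\hat L_{\delta_\chi}$, that is $\inf_{\mathcal{C}}E_g\lambda(\mathcal{C})$ divided by the expected length at $g$ of this FLCI, equals the same ratio, and so is at least the right-hand side. The right-hand side depends only on $\alpha$; for $\alpha=0.05$ it equals $0.717$ up to an error smaller than $0.0005$ (that is, $71.7\%$). -/

import Mathlib

open MeasureTheory ProbabilityTheory
open scoped NNReal ENNReal

namespace CATE

/-- The `p`-quantile `inf {x | μ (-∞, x] ≥ p}` of a probability distribution on the line. -/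
noncomputable def quantile (μ : Measure ℝ) (p : ℝ) : ℝ :=
  sInf {x : ℝ | ENNReal.ofReal p ≤ μ (Set.Iic x)}

/-- The standard normal quantile `z_p`. -/
noncomputable def z (p : ℝ) : ℝ := quantile (gaussianReal 0 1) p

/-- The critical value `cv_α(b)`: the `1 - α` quantile of `|N(b, 1)|`. -/
noncomputable def cv (α b : ℝ) : ℝ :=
  quantile ((gaussianReal b 1).map (fun t : ℝ => |t|)) (1 - α)

/-- The universal lower bound for the efficiency of the fixed-length interval:
`(z_{1-α}(1-α) - z̃ Φ(z̃) + φ(z_{1-α}) - φ(z̃)) / z_{1-α/2}`, `z̃ = z_{1-α} - z_{1-α/2}`. -/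
noncomputable def flciBound (α : ℝ) : ℝ :=
  let zt : ℝ := z (1 - α) - z (1 - α / 2)
  (z (1 - α) * (1 - α) - zt * cdf (gaussianReal 0 1) zt
    + gaussianPDFReal 0 1 (z (1 - α)) - gaussianPDFReal 0 1 zt) / z (1 - α / 2)

/-- `c` belongs to the superdifferential at `δ` of a function `ω` on `[0, ∞)`. -/
def IsSupergradient (ω : ℝ → ℝ) (δ c : ℝ) : Prop :=
  ∀ t : ℝ, 0 ≤ t → ω t ≤ ω δ + c * (t - δ)

/-- A regression function `f(x, d)` of the covariates `x ∈ ℝ^p` and the treatment `d ∈ {0, 1}`. -/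
abbrev RegFun (p : ℕ) : Type := (Fin p → ℝ) → Fin 2 → ℝ

/-- The fixed design: covariates, treatments, the known variance function (positive at the design
points), and the weights of the treatment effect of interest, which sum to one. -/
structure Design (n p : ℕ) where
  x : Fin n → (Fin p → ℝ)
  d : Fin n → Fin 2
  var : (Fin p → ℝ) → Fin 2 → ℝ≥0
  w : Fin n → ℝ
  var_pos : ∀ i, 0 < var (x i) (d i)
  sum_w : ∑ i, w i = 1

namespace Design

variable {n p : ℕ} (M : Design n p)

/-- The weighted conditional average treatment effect
`L f = ∑ i, w i (f(x i, 1) - f(x i, 0))`. -/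
def target (f : RegFun p) : ℝ := ∑ i, M.w i * (f (M.x i) 1 - f (M.x i) 0)

/-- The distribution `P_f` of the data: independent `y i ∼ N(f(x i, d i), σ²(x i, d i))`. -/
noncomputable def law (f : RegFun p) : Measure (Fin n → ℝ) :=
  Measure.pi fun i => gaussianReal (f (M.x i) (M.d i)) (M.var (M.x i) (M.d i))

/-- `∑ i, (f(x i, d i) - g(x i, d i))² / σ²(x i, d i)`. -/
noncomputable def sqDist (f g : RegFun p) : ℝ :=
  ∑ i, (f (M.x i) (M.d i) - g (M.x i) (M.d i)) ^ 2 / (M.var (M.x i) (M.d i) : ℝ)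

/-- The values `L g - L f` over the feasible pairs of the modulus problem at `δ`. -/
def modulusValues (F : Set (RegFun p)) (δ : ℝ) : Set ℝ :=
  {r | ∃ f ∈ F, ∃ g ∈ F, M.sqDist f g ≤ δ ^ 2 ∧ r = M.target g - M.target f}

/-- The modulus of continuity `ω(δ)` of `L` over `F`. -/
noncomputable def modulus (F : Set (RegFun p)) (δ : ℝ) : ℝ := sSup (M.modulusValues F δ)

/-- The pair `(f, g)` attains the supremum that defines `ω(δ)`. -/
def AttainsModulus (F : Set (RegFun p)) (δ : ℝ) (f g : RegFun p) : Prop :=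
  f ∈ F ∧ g ∈ F ∧ M.sqDist f g ≤ δ ^ 2 ∧
    ∀ r ∈ M.modulusValues F δ, r ≤ M.target g - M.target f

/-! ### Affine estimators and their bias and standard deviation -/

/-- The affine estimator `a + ∑ i, k i y i`. -/
def affineEst (k : Fin n → ℝ) (a : ℝ) (y : Fin n → ℝ) : ℝ := a + ∑ i, k i * y i

/-- The bias `E_f (T - L f)` of an estimator `T`. -/
noncomputable def bias (T : (Fin n → ℝ) → ℝ) (f : RegFun p) : ℝ :=
  ∫ y, (T y - M.target f) ∂(M.law f)

noncomputable def maxBias (F : Set (RegFun p)) (T : (Fin n → ℝ) → ℝ) : ℝ :=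
  sSup (M.bias T '' F)

noncomputable def minBias (F : Set (RegFun p)) (T : (Fin n → ℝ) → ℝ) : ℝ :=
  sInf (M.bias T '' F)

/-- The standard deviation of an affine estimator with weights `k`. -/
noncomputable def sd (k : Fin n → ℝ) : ℝ :=
  Real.sqrt (∑ i, k i ^ 2 * (M.var (M.x i) (M.d i) : ℝ))

/-- The weights `k*_δ` built from a solution `(f, g)` of the modulus problem at `δ` and an
element `c = ω'(δ)` of the superdifferential. -/
noncomputable def optWeights (δ c : ℝ) (f g : RegFun p) (i : Fin n) : ℝ :=
  c / δ * ((g (M.x i) (M.d i) - f (M.x i) (M.d i)) / (M.var (M.x i) (M.d i) : ℝ))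

/-- The centering constant `a*_δ`. -/
noncomputable def optCenter (δ c : ℝ) (f g : RegFun p) : ℝ :=
  (M.target (f + g)
    - ∑ i, M.optWeights δ c f g i * (f (M.x i) (M.d i) + g (M.x i) (M.d i))) / 2

/-- The estimator `L̂_δ`. -/
noncomputable def optEst (δ c : ℝ) (f g : RegFun p) : (Fin n → ℝ) → ℝ :=
  affineEst (M.optWeights δ c f g) (M.optCenter δ c f g)

/-- The lower endpoint `ĉ*_δ = L̂_δ - maxbias(L̂_δ) - z_{1-α} sd(L̂_δ)`. -/
noncomputable def optLower (F : Set (RegFun p)) (α δ c : ℝ) (f g : RegFun p)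
    (y : Fin n → ℝ) : ℝ :=
  M.optEst δ c f g y - M.maxBias F (M.optEst δ c f g) - z (1 - α) * M.sd (M.optWeights δ c f g)

/-- The fixed-length confidence interval `L̂_δ ± cv_α(b / sd) sd` around `L̂_δ`, where `b` is the
largest absolute bias over `F`. -/
noncomputable def flci (F : Set (RegFun p)) (α δ c : ℝ) (f g : RegFun p)
    (y : Fin n → ℝ) : Set ℝ :=
  let T := M.optEst δ c f g
  let s := M.sd (M.optWeights δ c f g)
  let b := max |M.maxBias F T| |M.minBias F T|
  Set.Icc (T y - cv α (b / s) * s) (T y + cv α (b / s) * s)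

/-! ### Confidence sets and their performance -/

/-- `C` is a `1 - α` confidence set for `L f` over `F`: it is (jointly) measurable and
`inf_{f ∈ F} P_f (L f ∈ C) ≥ 1 - α`. -/
def IsConfSet (F : Set (RegFun p)) (α : ℝ) (C : (Fin n → ℝ) → Set ℝ) : Prop :=
  MeasurableSet {q : (Fin n → ℝ) × ℝ | q.2 ∈ C q.1} ∧
    ENNReal.ofReal (1 - α) ≤ ⨅ f ∈ F, M.law f {y | M.target f ∈ C y}

/-- `q_β(ĉ, G)`: the worst-case `β`-quantile over `G` of the excess length `L g - ĉ` of the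
one-sided interval `[ĉ, ∞)`. -/
noncomputable def excessQuantile (β : ℝ) (chat : (Fin n → ℝ) → ℝ) (G : Set (RegFun p)) : ℝ :=
  sSup ((fun g => quantile ((M.law g).map (fun y => M.target g - chat y)) β) '' G)

/-- The infimum of `q_β(ĉ, G)` over all `1 - α` one-sided confidence intervals `[ĉ, ∞)`. -/
noncomputable def bestExcessQuantile (F : Set (RegFun p)) (α β : ℝ) (G : Set (RegFun p)) : ℝ :=
  sInf {q | ∃ chat : (Fin n → ℝ) → ℝ,
    M.IsConfSet F α (fun y => Set.Ici (chat y)) ∧ q = M.excessQuantile β chat G}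

/-- The expected Lebesgue measure `E_g λ(C)` of a confidence set. -/
noncomputable def expLength (g : RegFun p) (C : (Fin n → ℝ) → Set ℝ) : ℝ≥0∞ :=
  ∫⁻ y, volume (C y) ∂(M.law g)

/-- The infimum of `E_g λ(C)` over all `1 - α` confidence sets. -/
noncomputable def bestExpLength (F : Set (RegFun p)) (α : ℝ) (g : RegFun p) : ℝ≥0∞ :=
  ⨅ (C : (Fin n → ℝ) → Set ℝ) (_ : M.IsConfSet F α C), M.expLength g C

/-- The length `2 cv_α(ω(δ) / (2 ω'(δ)) - δ / 2) ω'(δ)`, for a choice `ω'` of elements of the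
superdifferentials. -/
noncomputable def flciLength (F : Set (RegFun p)) (α : ℝ) (ω' : ℝ → ℝ) (δ : ℝ) : ℝ :=
  2 * cv α (M.modulus F δ / (2 * ω' δ) - δ / 2) * ω' δ

/-- `(1 - α) E[ω(2 (z_{1-α} - Z)) | Z ≤ z_{1-α}]` with `Z` standard normal. -/
noncomputable def adaptLength (F : Set (RegFun p)) (α : ℝ) : ℝ :=
  (1 - α) * ∫ t, M.modulus F (2 * (z (1 - α) - t))
    ∂(ProbabilityTheory.cond (gaussianReal 0 1) (Set.Iic (z (1 - α))))

end Design

end CATE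

/-! Dividing each observation by its standard deviation turns the data into a vector with law N(`obs
f`, I), and ‖f - g‖_σ becomes the Euclidean norm of `obs f - obs g`. Convexity and centrosymmetry
let any pair (f, g) in the modulus problem be replaced by (-h, h) with h = (g - f)/2, so ω(δ) is
twice the supremum of L h over h ∈ F with 2‖`obs h`‖ ≤ δ. The condition on g makes F invariant under
translation by g, so every f ∈ F can be written g + h with h ∈ F.

Lower bounds come from Neyman–Pearson (`law_ge_of_law_ge`): coverage 1 - α at f forces the same
event to have probability at least Φ(z_{1-α} - ‖f - g‖_σ) under g.

One-sided intervals. Testing g - h against g shows that no excess quantile at g is below ω(2δ)/2.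
Separating the convex set of pairs (`obs f`, L f) from a ball times a ray gives a linear statistic
that reaches this value (`exists_optimal_weights`); its bias vanishes at g because all multiples k g
lie in F. Perturbing f* inside F (`inner_sub_target_le`) shows that L̂_δ has maximal bias (ω(δ) -
δω')/2 and standard deviation ω', hence excess quantile (ω(δ) + δω')/2 at g. The bound 1/2 follows
from δω' ≤ ω(δ) ≤ ω(2δ).

Two-sided sets. By Fubini, expected length at g is the integral over τ of the probability under g of
covering τ + L g. Let k τ be a norm minimizer in F with target τ. The integrand is at least
Φ(z_{1-α} - ‖k τ‖), and inverting the tests of g + k τ against g attains all these bounds at once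
(`exists_isConfSet_expLength_eq`). Since ‖k τ‖ ≤ s holds on an interval of length ω(2s), a second
use of Fubini yields the truncated Gaussian integral of ω.

Universal bound. Let q = z_{1-α/2}. Since cv_α(b) ≤ b + q, ℓ(2q) ≤ ω(2q). Star-shapedness gives
ω(2s) ≥ min(s/q, 1) ω(2q), and the Gaussian integral of min(s/q, 1) is the stated constant. Its
value at α = 0.05 is enclosed by alternating Taylor series. -/

namespace CATE

/-! ### Quantiles -/

section Quantile
open Filter Topology

variable (μ : Measure ℝ) [IsProbabilityMeasure μ] {p : ℝ}

lemma quantile_set_bddBelow (hp : 0 < p) :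
    BddBelow {x : ℝ | ENNReal.ofReal p ≤ μ (Set.Iic x)} := by
  obtain ⟨a, ha⟩ := ((tendsto_cdf_atBot μ).eventually (gt_mem_nhds hp)).exists
  refine ⟨a, fun x hx => ?_⟩
  by_contra! hlt
  rw [Set.mem_ofPred_eq, ← ofReal_cdf] at hx
  have h1 := (ENNReal.ofReal_le_ofReal_iff (cdf_nonneg μ x)).1 hx
  linarith [monotone_cdf μ hlt.le]

lemma quantile_set_nonempty (hp : p < 1) :
    {x : ℝ | ENNReal.ofReal p ≤ μ (Set.Iic x)}.Nonempty := by
  obtain ⟨a, ha⟩ := ((tendsto_cdf_atTop μ).eventually (lt_mem_nhds hp)).exists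
  exact ⟨a, by rw [Set.mem_ofPred_eq, ← ofReal_cdf]; exact ENNReal.ofReal_le_ofReal ha.le⟩

lemma quantile_le (hp : 0 < p) {x : ℝ} (h : ENNReal.ofReal p ≤ μ (Set.Iic x)) :
    quantile μ p ≤ x :=
  csInf_le (quantile_set_bddBelow μ hp) h

/-- The infimum defining the quantile is attained because a distribution function is right
continuous. -/
lemma le_measure_Iic_quantile (hp : p < 1) :
    ENNReal.ofReal p ≤ μ (Set.Iic (quantile μ p)) := by
  rw [← ofReal_cdf]
  refine ENNReal.ofReal_le_ofReal ?_
  have hc := (cdf μ).right_continuous (quantile μ p)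
  have hc' : Tendsto (cdf μ) (𝓝[>] (quantile μ p)) (𝓝 (cdf μ (quantile μ p))) :=
    hc.tendsto.mono_left (nhdsWithin_mono _ Set.Ioi_subset_Ici_self)
  refine ge_of_tendsto hc' ?_
  filter_upwards [self_mem_nhdsWithin] with x hx
  obtain ⟨y, hy, hyx⟩ := exists_lt_of_csInf_lt (quantile_set_nonempty μ hp) hx
  rw [Set.mem_ofPred_eq, ← ofReal_cdf] at hy
  exact ((ENNReal.ofReal_le_ofReal_iff (cdf_nonneg μ y)).1 hy).trans (monotone_cdf μ hyx.le)

lemma quantile_le_iff (hp0 : 0 < p) (hp : p < 1) {x : ℝ} :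
    quantile μ p ≤ x ↔ ENNReal.ofReal p ≤ μ (Set.Iic x) :=
  ⟨fun h => (le_measure_Iic_quantile μ hp).trans (measure_mono (Set.Iic_subset_Iic.2 h)),
    quantile_le μ hp0⟩

end Quantile

/-! ### The standard normal distribution function -/

/-- The standard normal distribution function. -/
noncomputable def Phi (x : ℝ) : ℝ := cdf (gaussianReal 0 1) x

lemma ofReal_Phi (x : ℝ) : ENNReal.ofReal (Phi x) = gaussianReal 0 1 (Set.Iic x) := ofReal_cdf _ x

lemma Phi_eq_real (x : ℝ) : Phi x = (gaussianReal 0 1).real (Set.Iic x) := cdf_eq_real _ x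

lemma Phi_nonneg (x : ℝ) : 0 ≤ Phi x := cdf_nonneg _ x

lemma Phi_le_one (x : ℝ) : Phi x ≤ 1 := cdf_le_one _ x

lemma Phi_mono : Monotone Phi := monotone_cdf _

lemma continuous_gaussianPDFReal : Continuous (gaussianPDFReal 0 1) := by
  unfold gaussianPDFReal; fun_prop

lemma Phi_eq_integral (x : ℝ) : Phi x = ∫ t in Set.Iic x, gaussianPDFReal 0 1 t := by
  rw [Phi_eq_real, Measure.real, gaussianReal_apply_eq_integral _ one_ne_zero,
    ENNReal.toReal_ofReal (integral_nonneg fun t => gaussianPDFReal_nonneg 0 1 t)]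

lemma Phi_sub (a b : ℝ) : Phi b - Phi a = ∫ t in a..b, gaussianPDFReal 0 1 t := by
  rw [Phi_eq_integral, Phi_eq_integral,
    intervalIntegral.integral_Iic_sub_Iic (integrable_gaussianPDFReal 0 1).integrableOn
      (integrable_gaussianPDFReal 0 1).integrableOn]

lemma hasDerivAt_Phi (x : ℝ) : HasDerivAt Phi (gaussianPDFReal 0 1 x) x := by
  have h : Phi = fun b => (∫ t in (0:ℝ)..b, gaussianPDFReal 0 1 t) + Phi 0 := by
    ext b; rw [← Phi_sub]; ring
  rw [h]
  exact (intervalIntegral.integral_hasDerivAt_right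
    (continuous_gaussianPDFReal.intervalIntegrable _ _)
    continuous_gaussianPDFReal.stronglyMeasurable.stronglyMeasurableAtFilter
    continuous_gaussianPDFReal.continuousAt).add_const _

lemma continuous_Phi : Continuous Phi :=
  continuous_iff_continuousAt.2 fun x => (hasDerivAt_Phi x).continuousAt

lemma strictMono_Phi : StrictMono Phi :=
  strictMono_of_deriv_pos fun x => by
    rw [(hasDerivAt_Phi x).deriv]; exact gaussianPDFReal_pos 0 1 x one_ne_zero

lemma gaussianPDFReal_even (t : ℝ) : gaussianPDFReal 0 1 (-t) = gaussianPDFReal 0 1 t := by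
  simp [gaussianPDFReal]

lemma Phi_neg (x : ℝ) : Phi (-x) = 1 - Phi x := by
  have h1 : (gaussianReal 0 1).map (fun t : ℝ => -t) = gaussianReal 0 1 := by
    rw [gaussianReal_map_neg, neg_zero]
  have := nullSingletonClass_gaussianReal (μ := 0) (v := 1) one_ne_zero
  have h2 : (gaussianReal 0 1).real (Set.Iic (-x)) = (gaussianReal 0 1).real (Set.Ici x) := by
    conv_lhs => rw [← h1]
    rw [map_measureReal_apply measurable_neg measurableSet_Iic]
    congr 1; ext t; simp
  rw [Phi_eq_real, h2, Phi_eq_real, ← probReal_compl_eq_one_sub measurableSet_Iic, Set.compl_Iic,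
    measureReal_congr Ioi_ae_eq_Ici]

lemma Phi_zero : Phi 0 = 1 / 2 := by
  have := Phi_neg 0
  rw [neg_zero] at this; linarith

lemma tendsto_Phi_atTop : Filter.Tendsto Phi Filter.atTop (nhds 1) := tendsto_cdf_atTop _

lemma tendsto_Phi_atBot : Filter.Tendsto Phi Filter.atBot (nhds 0) := tendsto_cdf_atBot _

lemma exists_Phi_eq {p : ℝ} (h0 : 0 < p) (h1 : p < 1) : ∃ x, Phi x = p := by
  obtain ⟨a, ha⟩ := (tendsto_Phi_atBot.eventually (gt_mem_nhds h0)).exists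
  obtain ⟨b, hb⟩ := (tendsto_Phi_atTop.eventually (lt_mem_nhds h1)).exists
  exact mem_range_of_exists_le_of_exists_ge continuous_Phi ⟨a, ha.le⟩ ⟨b, hb.le⟩

lemma z_le_iff {p x : ℝ} (h0 : 0 < p) (h1 : p < 1) : z p ≤ x ↔ p ≤ Phi x := by
  rw [z, quantile_le_iff _ h0 h1, ← ofReal_Phi, ENNReal.ofReal_le_ofReal_iff (Phi_nonneg x)]

lemma Phi_z {p : ℝ} (h0 : 0 < p) (h1 : p < 1) : Phi (z p) = p := by
  obtain ⟨x, rfl⟩ := exists_Phi_eq h0 h1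
  have : z (Phi x) = x := le_antisymm ((z_le_iff h0 h1).2 le_rfl)
    (strictMono_Phi.le_iff_le.1 ((z_le_iff h0 h1).1 le_rfl))
  rw [this]

lemma lt_z_iff {p x : ℝ} (h0 : 0 < p) (h1 : p < 1) : x < z p ↔ Phi x < p := by
  rw [← not_le, z_le_iff h0 h1, not_le]

lemma gaussianReal_eq_map (m s : ℝ) :
    gaussianReal m (s ^ 2).toNNReal = (gaussianReal 0 1).map (fun t => m + s * t) := by
  have h : (fun t : ℝ => m + s * t) = (fun t => m + t) ∘ (fun t => s * t) := rfl
  rw [h, ← Measure.map_map (by fun_prop) (by fun_prop), gaussianReal_map_const_mul,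
    gaussianReal_map_const_add]
  congr 1
  · ring
  · ext; simp [sq_nonneg]

lemma gaussianReal_real_Iic {m s : ℝ} (hs : 0 < s) (x : ℝ) :
    (gaussianReal m (s ^ 2).toNNReal).real (Set.Iic x) = Phi ((x - m) / s) := by
  rw [gaussianReal_eq_map, map_measureReal_apply (by fun_prop) measurableSet_Iic, Phi_eq_real]
  congr 1; ext t
  simp only [Set.mem_preimage, Set.mem_Iic]
  rw [le_div_iff₀ hs]
  constructor <;> intro h <;> linarith

lemma gaussianReal_Iic {m s : ℝ} (hs : 0 < s) (x : ℝ) :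
    gaussianReal m (s ^ 2).toNNReal (Set.Iic x) = ENNReal.ofReal (Phi ((x - m) / s)) := by
  rw [← gaussianReal_real_Iic hs, ofReal_measureReal]

lemma gaussianReal_Ici {m s : ℝ} (hs : 0 < s) (x : ℝ) :
    gaussianReal m (s ^ 2).toNNReal (Set.Ici x) = ENNReal.ofReal (Phi ((m - x) / s)) := by
  rw [gaussianReal_eq_map, Measure.map_apply (by fun_prop) measurableSet_Ici]
  have h1 : (gaussianReal 0 1).map (fun t : ℝ => -t) = gaussianReal 0 1 := by
    rw [gaussianReal_map_neg, neg_zero]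
  rw [ofReal_Phi]
  conv_rhs => rw [← h1]
  rw [Measure.map_apply (by fun_prop) measurableSet_Iic]
  congr 1; ext t
  simp only [Set.mem_preimage, Set.mem_Ici, Set.mem_Iic]
  rw [le_div_iff₀ hs]
  constructor <;> intro h <;> linarith

lemma quantile_gaussianReal {m s p : ℝ} (hs : 0 ≤ s) (h0 : 0 < p) (h1 : p < 1) :
    quantile (gaussianReal m (s ^ 2).toNNReal) p = m + s * z p := by
  refine eq_of_forall_ge_iff fun x => ?_
  rw [quantile_le_iff _ h0 h1]
  -- Zero variance is a Dirac mass. It has to be covered because the weight vector of a linear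
  -- statistic may vanish.
  rcases hs.eq_or_lt with rfl | hs
  · have : ((0:ℝ) ^ 2).toNNReal = 0 := by simp
    rw [this, gaussianReal_zero_var, Measure.dirac_apply' _ measurableSet_Iic, zero_mul, add_zero,
      Set.indicator_apply]
    by_cases h : m ≤ x
    · simp [h, h1.le]
    · simp [h, h0]
  · rw [gaussianReal_Iic hs, ENNReal.ofReal_le_ofReal_iff (Phi_nonneg _), ← z_le_iff h0 h1,
      le_div_iff₀ hs]
    constructor <;> intro h <;> linarith


/-! ### The Gaussian model -/

lemma pi_withDensity {ι : Type*} [Fintype ι] (μ : ι → Measure ℝ) [∀ i, IsProbabilityMeasure (μ i)]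
    (D : ι → ℝ → ℝ≥0∞) (hD : ∀ i, Measurable (D i))
    [∀ i, IsProbabilityMeasure ((μ i).withDensity (D i))] :
    Measure.pi (fun i => (μ i).withDensity (D i))
      = (Measure.pi μ).withDensity (fun y => ∏ i, D i (y i)) := by
  refine (Measure.pi_eq fun s hs => ?_)
  rw [withDensity_apply _ (MeasurableSet.univ_pi hs), ← lintegral_indicator (MeasurableSet.univ_pi hs)]
  have h1 : (Set.univ.pi s).indicator (fun y : ι → ℝ => ∏ i, D i (y i))
      = fun y => ∏ i, (s i).indicator (D i) (y i) := by
    ext y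
    by_cases hy : y ∈ Set.univ.pi s
    · rw [Set.indicator_of_mem hy]
      exact Finset.prod_congr rfl fun i _ =>
        (Set.indicator_of_mem (hy i (Set.mem_univ i)) _).symm
    · rw [Set.indicator_of_notMem hy]
      simp only [Set.mem_univ_pi, not_forall] at hy
      obtain ⟨i, hi⟩ := hy
      exact (Finset.prod_eq_zero (Finset.mem_univ i) (Set.indicator_of_notMem hi _)).symm
  rw [h1]
  have hind : iIndepFun (fun i (y : ι → ℝ) => (s i).indicator (D i) (y i)) (Measure.pi μ) :=
    iIndepFun_pi fun i => ((hD i).indicator (hs i)).aemeasurable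
  rw [lintegral_prod_eq_prod_lintegral_of_indepFun _ _ hind
    (fun i => ((hD i).indicator (hs i)).comp (measurable_pi_apply i))]
  refine Finset.prod_congr rfl fun i _ => ?_
  rw [withDensity_apply _ (hs i), ← lintegral_indicator (hs i)]
  have := (measurePreserving_eval μ i).lintegral_comp ((hD i).indicator (hs i))
  exact this

lemma gaussianReal_withDensity (a b : ℝ) {v : ℝ≥0} (hv : v ≠ 0) :
    gaussianReal b v = (gaussianReal a v).withDensity
      (fun t => ENNReal.ofReal (Real.exp ((b - a) * (t - a) / v - (b - a) ^ 2 / (2 * v)))) := by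
  have hv' : (v : ℝ) ≠ 0 := by exact_mod_cast hv
  rw [gaussianReal_of_var_ne_zero _ hv, gaussianReal_of_var_ne_zero _ hv,
    ← withDensity_mul _ (measurable_gaussianPDF a v) (by fun_prop)]
  congr 1; ext t
  simp only [Pi.mul_apply, gaussianPDF]
  rw [← ENNReal.ofReal_mul (gaussianPDFReal_nonneg _ _ _)]
  congr 1
  rw [gaussianPDFReal, gaussianPDFReal, mul_assoc (√_)⁻¹, ← Real.exp_add]
  congr 2
  field_simp; ring

namespace Design
open scoped RealInnerProductSpace

variable {n p : ℕ} (M : Design n p)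

/-- The data, standardized to unit variances. -/
noncomputable def scale (y : Fin n → ℝ) : EuclideanSpace ℝ (Fin n) :=
  WithLp.toLp 2 fun i => y i / Real.sqrt (M.var (M.x i) (M.d i))

/-- The standardized mean of the data. -/
noncomputable def obs : RegFun p →ₗ[ℝ] EuclideanSpace ℝ (Fin n) where
  toFun f := M.scale fun i => f (M.x i) (M.d i)
  map_add' f g := by ext i; simp [scale, add_div]
  map_smul' c f := by ext i; simp [scale, mul_div_assoc]

lemma sqrt_var_pos (i : Fin n) : 0 < Real.sqrt (M.var (M.x i) (M.d i)) :=
  Real.sqrt_pos.2 (M.var_pos i)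

lemma sq_sqrt_var (i : Fin n) :
    Real.sqrt (M.var (M.x i) (M.d i)) ^ 2 = M.var (M.x i) (M.d i) :=
  Real.sq_sqrt (M.var (M.x i) (M.d i)).2

@[simp] lemma scale_apply (y : Fin n → ℝ) (i : Fin n) :
    M.scale y i = y i / Real.sqrt (M.var (M.x i) (M.d i)) := rfl

@[simp] lemma obs_apply (f : RegFun p) (i : Fin n) :
    M.obs f i = f (M.x i) (M.d i) / Real.sqrt (M.var (M.x i) (M.d i)) := rfl

lemma measurable_scale : Measurable M.scale := by
  unfold scale; fun_prop

lemma sqDist_eq (f g : RegFun p) : M.sqDist f g = ‖M.obs f - M.obs g‖ ^ 2 := by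
  rw [sqDist, EuclideanSpace.real_norm_sq_eq]
  refine Finset.sum_congr rfl fun i _ => ?_
  simp only [PiLp.sub_apply, obs_apply]
  rw [← sub_div, div_pow, sq_sqrt_var]

instance (f : RegFun p) : IsProbabilityMeasure (M.law f) := by
  unfold law; infer_instance

/-- Characteristic functions are compared: at `t`, the one of the linear statistic is that of the
product law at the vector `w`, which factors over the coordinates. -/
lemma law_map_inner (f : RegFun p) (u : EuclideanSpace ℝ (Fin n)) :
    (M.law f).map (fun y => ⟪u, M.scale y⟫) = gaussianReal ⟪u, M.obs f⟫ (‖u‖ ^ 2).toNNReal := by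
  have hm : Measurable fun y => ⟪u, M.scale y⟫ := by
    have := M.measurable_scale
    fun_prop
  have : IsProbabilityMeasure ((M.law f).map (fun y => ⟪u, M.scale y⟫)) :=
    Measure.isProbabilityMeasure_map hm.aemeasurable
  apply Measure.ext_of_charFun
  ext t
  set w : EuclideanSpace ℝ (Fin n) :=
    WithLp.toLp 2 fun i => t * (u i / Real.sqrt (M.var (M.x i) (M.d i))) with hw
  have h1 : charFun ((M.law f).map (fun y => ⟪u, M.scale y⟫)) t
      = charFun ((M.law f).map (WithLp.toLp 2)) w := by
    rw [charFun_apply, charFun_apply, integral_map hm.aemeasurable (by fun_prop),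
      integral_map (by fun_prop) (by fun_prop)]
    congr 1; ext y
    congr 3
    simp only [PiLp.inner_apply, hw, scale_apply, RCLike.inner_apply, conj_trivial]
    rw [Finset.mul_sum]
    exact Finset.sum_congr rfl fun i _ => by ring
  rw [h1, law, charFun_pi]
  simp_rw [charFun_gaussianReal]
  rw [← Complex.exp_sum]
  congr 1
  rw [Finset.sum_sub_distrib, Real.coe_toNNReal _ (sq_nonneg _), EuclideanSpace.real_norm_sq_eq,
    PiLp.inner_apply]
  congr 1
  · push_cast
    rw [Finset.mul_sum, Finset.sum_mul]
    refine Finset.sum_congr rfl fun i _ => ?_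
    simp only [hw, obs_apply, RCLike.inner_apply, conj_trivial]
    push_cast; ring
  · push_cast
    rw [Finset.sum_mul, Finset.sum_div]
    refine Finset.sum_congr rfl fun i _ => ?_
    have h2 : ((M.var (M.x i) (M.d i) : ℝ) : ℂ)
        = (Real.sqrt (M.var (M.x i) (M.d i)) : ℂ) ^ 2 := by
      rw [← Complex.ofReal_pow, sq_sqrt_var]
    have h3 : (Real.sqrt (M.var (M.x i) (M.d i)) : ℂ) ≠ 0 := by
      exact_mod_cast (M.sqrt_var_pos i).ne'
    simp only [hw]
    push_cast
    rw [h2]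
    field_simp

/-- The likelihood ratio is increasing in a single linear statistic of the standardized data, so
Neyman–Pearson tests are half-spaces. -/
lemma law_eq_withDensity (f g : RegFun p) :
    M.law g = (M.law f).withDensity fun y => ENNReal.ofReal
      (Real.exp (⟪M.obs g - M.obs f, M.scale y - M.obs f⟫ - ‖M.obs g - M.obs f‖ ^ 2 / 2)) := by
  have hv : ∀ i, M.var (M.x i) (M.d i) ≠ 0 := fun i => (M.var_pos i).ne'
  set D : Fin n → ℝ → ℝ≥0∞ := fun i t => ENNReal.ofReal (Real.exp
    ((g (M.x i) (M.d i) - f (M.x i) (M.d i)) * (t - f (M.x i) (M.d i)) / M.var (M.x i) (M.d i)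
      - (g (M.x i) (M.d i) - f (M.x i) (M.d i)) ^ 2 / (2 * M.var (M.x i) (M.d i)))) with hDdef
  have hD : ∀ i, Measurable (D i) := fun i => by simp only [hDdef]; fun_prop
  have hP : ∀ i, gaussianReal (g (M.x i) (M.d i)) (M.var (M.x i) (M.d i))
      = (gaussianReal (f (M.x i) (M.d i)) (M.var (M.x i) (M.d i))).withDensity (D i) :=
    fun i => gaussianReal_withDensity _ _ (hv i)
  have : ∀ i, IsProbabilityMeasure
      ((gaussianReal (f (M.x i) (M.d i)) (M.var (M.x i) (M.d i))).withDensity (D i)) :=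
    fun i => by rw [← hP i]; infer_instance
  rw [law, law]
  simp_rw [hP]
  rw [pi_withDensity _ D hD]
  congr 1; ext y
  simp only [hDdef]
  rw [← ENNReal.ofReal_prod_of_nonneg fun i _ => (Real.exp_pos _).le, ← Real.exp_sum]
  congr 2
  rw [Finset.sum_sub_distrib, EuclideanSpace.real_norm_sq_eq, PiLp.inner_apply, Finset.sum_div]
  congr 1 <;> refine Finset.sum_congr rfl fun i _ => ?_
  · simp only [PiLp.sub_apply, obs_apply, scale_apply, RCLike.inner_apply, conj_trivial]
    have := (M.sqrt_var_pos i).ne'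
    rw [← sub_div, ← sub_div, div_mul_div_comm, ← sq, M.sq_sqrt_var i, mul_comm]
  · simp only [PiLp.sub_apply, obs_apply]
    rw [← sub_div, div_pow, M.sq_sqrt_var i, div_div, mul_comm (2 : ℝ)]

lemma measurable_inner_scale (u v : EuclideanSpace ℝ (Fin n)) :
    Measurable fun y => ⟪u, M.scale y - v⟫ := by
  have := M.measurable_scale
  fun_prop

lemma law_map_inner_sub (f : RegFun p) (u v : EuclideanSpace ℝ (Fin n)) :
    (M.law f).map (fun y => ⟪u, M.scale y - v⟫)
      = gaussianReal ⟪u, M.obs f - v⟫ (‖u‖ ^ 2).toNNReal := by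
  have h : (fun y => ⟪u, M.scale y - v⟫) = (fun t => t - ⟪u, v⟫) ∘ fun y => ⟪u, M.scale y⟫ := by
    ext y; simp [inner_sub_right]
  have hm : Measurable fun y => ⟪u, M.scale y⟫ := by simpa using M.measurable_inner_scale u 0
  rw [h, ← Measure.map_map (by fun_prop) hm, law_map_inner, gaussianReal_map_sub_const,
    inner_sub_right]

lemma law_inner_le {u : EuclideanSpace ℝ (Fin n)} (hu : u ≠ 0) (f : RegFun p)
    (v : EuclideanSpace ℝ (Fin n)) (t : ℝ) :
    M.law f {y | ⟪u, M.scale y - v⟫ ≤ t}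
      = ENNReal.ofReal (Phi ((t - ⟪u, M.obs f - v⟫) / ‖u‖)) := by
  rw [← gaussianReal_Iic (norm_pos_iff.2 hu), ← law_map_inner_sub,
    Measure.map_apply (M.measurable_inner_scale u v) measurableSet_Iic]
  rfl

/-- The Neyman–Pearson bound: an event of probability at least `1 - α` under `f` has probability
at least `Φ(z_{1-α} - ‖f - g‖)` under `g`. -/
lemma law_ge_of_law_ge {α : ℝ} (hα : α ∈ Set.Ioo (0 : ℝ) 1) (f g : RegFun p)
    {S : Set (Fin n → ℝ)} (hS : MeasurableSet S) (h : ENNReal.ofReal (1 - α) ≤ M.law f S) :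
    ENNReal.ofReal (Phi (z (1 - α) - ‖M.obs g - M.obs f‖)) ≤ M.law g S := by
  have hz : Phi (z (1 - α)) = 1 - α := Phi_z (by linarith [hα.2]) (by linarith [hα.1])
  set u := M.obs g - M.obs f with hu
  set D : (Fin n → ℝ) → ℝ≥0∞ := fun y => ENNReal.ofReal
      (Real.exp (⟪u, M.scale y - M.obs f⟫ - ‖u‖ ^ 2 / 2)) with hD
  have hDm : Measurable D := by
    have := M.measurable_inner_scale u (M.obs f)
    simp only [hD]; fun_prop
  have hlaw : M.law g = (M.law f).withDensity D := M.law_eq_withDensity f g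
  rcases eq_or_ne u 0 with h0 | h0
  · have : D = 1 := by ext y; simp [hD, h0]
    rw [hlaw, this, withDensity_one, h0, norm_zero, sub_zero, hz]
    exact h
  have hupos : 0 < ‖u‖ := norm_pos_iff.2 h0
  -- The half-space of probability exactly 1 - α under `f` on which the likelihood ratio is
  -- smallest; `κ` is the ratio on its boundary.
  set T : Set (Fin n → ℝ) := {y | ⟪u, M.scale y - M.obs f⟫ ≤ z (1 - α) * ‖u‖} with hT
  have hTm : MeasurableSet T := (M.measurable_inner_scale u (M.obs f)) measurableSet_Iic
  have hTf : M.law f T = ENNReal.ofReal (1 - α) := by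
    rw [hT, law_inner_le _ h0, sub_self, inner_zero_right, sub_zero,
      mul_div_cancel_right₀ _ hupos.ne', hz]
  have hTg : M.law g T = ENNReal.ofReal (Phi (z (1 - α) - ‖u‖)) := by
    rw [hT, law_inner_le _ h0, ← hu, real_inner_self_eq_norm_sq]
    congr 2; field_simp
  rw [← hTg]
  set κ : ℝ≥0∞ := ENNReal.ofReal (Real.exp (z (1 - α) * ‖u‖ - ‖u‖ ^ 2 / 2)) with hκ
  have hle : ∀ y ∈ T, D y ≤ κ := fun y hy =>
    ENNReal.ofReal_le_ofReal (Real.exp_le_exp.2 (sub_le_sub_right hy _))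
  have hge : ∀ y ∉ T, κ ≤ D y := fun y hy =>
    ENNReal.ofReal_le_ofReal (Real.exp_le_exp.2 (sub_le_sub_right (not_le.1 hy).le _))
  -- Only the parts outside `T ∩ S` differ. Passing from `f` to `g` multiplies the mass of `T \ S`
  -- by at most `κ` and that of `S \ T` by at least `κ`.
  have hdiff : M.law f (T \ S) ≤ M.law f (S \ T) := by
    have h1 : M.law f (T ∩ S) + M.law f (T \ S) = M.law f T := measure_inter_add_sdiff T hS
    have h2 : M.law f (S ∩ T) + M.law f (S \ T) = M.law f S := measure_inter_add_sdiff S hTm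
    rw [Set.inter_comm] at h2
    refine (ENNReal.add_le_add_iff_left (measure_ne_top (M.law f) (T ∩ S))).1 ?_
    rw [h1, h2, hTf]; exact h
  have hgd : M.law g (T \ S) ≤ M.law g (S \ T) := by
    rw [hlaw, withDensity_apply _ (hTm.diff hS), withDensity_apply _ (hS.diff hTm)]
    calc ∫⁻ y in T \ S, D y ∂(M.law f) ≤ ∫⁻ _ in T \ S, κ ∂(M.law f) :=
          setLIntegral_mono measurable_const fun y hy => hle y hy.1
      _ = κ * M.law f (T \ S) := setLIntegral_const _ _
      _ ≤ κ * M.law f (S \ T) := by gcongr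
      _ = ∫⁻ _ in S \ T, κ ∂(M.law f) := (setLIntegral_const _ _).symm
      _ ≤ ∫⁻ y in S \ T, D y ∂(M.law f) := setLIntegral_mono hDm fun y hy => hge y hy.2
  rw [← measure_inter_add_sdiff T hS, ← measure_inter_add_sdiff S hTm, Set.inter_comm]
  gcongr

end Design

lemma le_of_forall_mul_le {x y : ℝ} (h : ∀ t ∈ Set.Ioo (0 : ℝ) 1, t * x ≤ y) : x ≤ y := by
  have h1 : Filter.Tendsto (fun t : ℝ => t * x) (nhdsWithin 1 (Set.Iio 1)) (nhds (1 * x)) :=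
    ((continuous_id.mul continuous_const).tendsto 1).mono_left nhdsWithin_le_nhds
  rw [one_mul] at h1
  refine le_of_tendsto h1 ?_
  filter_upwards [Ioo_mem_nhdsLT (zero_lt_one' ℝ)] with t ht using h t ht

/-- Let t → 0. This discards the second-order term in a perturbation along a segment of the convex
class. -/
lemma nonpos_of_forall_le_mul {x y : ℝ} (h : ∀ t ∈ Set.Ioo (0 : ℝ) 1, x ≤ t * y) : x ≤ 0 := by
  have h1 : Filter.Tendsto (fun t : ℝ => t * y) (nhdsWithin 0 (Set.Ioi 0)) (nhds (0 * y)) :=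
    ((continuous_id.mul continuous_const).tendsto 0).mono_left nhdsWithin_le_nhds
  rw [zero_mul] at h1
  refine ge_of_tendsto h1 ?_
  filter_upwards [Ioo_mem_nhdsGT (zero_lt_one' ℝ)] with t ht using h t ht

namespace Design
open scoped RealInnerProductSpace

variable {n p : ℕ} (M : Design n p)

/-! ### The modulus of continuity over a convex, centrosymmetric class -/

lemma target_add (f g : RegFun p) : M.target (f + g) = M.target f + M.target g := by
  simp only [target, Pi.add_apply, ← Finset.sum_add_distrib]
  exact Finset.sum_congr rfl fun i _ => by ring

lemma target_smul (c : ℝ) (f : RegFun p) : M.target (c • f) = c * M.target f := by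
  simp only [target, Pi.smul_apply, smul_eq_mul, Finset.mul_sum]
  exact Finset.sum_congr rfl fun i _ => by ring

lemma target_neg (f : RegFun p) : M.target (-f) = -M.target f := by
  rw [← neg_one_smul ℝ, target_smul, neg_one_mul]

lemma target_sub (f g : RegFun p) : M.target (f - g) = M.target f - M.target g := by
  rw [sub_eq_add_neg, target_add, target_neg, sub_eq_add_neg]

lemma target_zero : M.target 0 = 0 := by simp [target]

variable {M} {F : Set (RegFun p)} {g : RegFun p}

lemma half_sub_mem (hconv : Convex ℝ F) (hsymm : ∀ f ∈ F, -f ∈ F) {f h : RegFun p} (hf : f ∈ F)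
    (hh : h ∈ F) : (1 / 2 : ℝ) • (f - h) ∈ F := by
  have := hconv hf (hsymm h hh) (by norm_num : (0 : ℝ) ≤ 1 / 2) (by norm_num : (0 : ℝ) ≤ 1 / 2)
    (by norm_num)
  rwa [← smul_add, ← sub_eq_add_neg] at this

lemma zero_mem_class (hg : g ∈ F) (hgF : ∀ f ∈ F, f - g ∈ F) : (0 : RegFun p) ∈ F := by
  simpa using hgF g hg

lemma smul_mem_class (hconv : Convex ℝ F) (h0 : (0 : RegFun p) ∈ F) {f : RegFun p} (hf : f ∈ F)
    {t : ℝ} (ht0 : 0 ≤ t) (ht1 : t ≤ 1) : t • f ∈ F := by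
  have := hconv hf h0 ht0 (sub_nonneg.2 ht1) (by ring)
  simpa using this

lemma add_mem_class (hsymm : ∀ f ∈ F, -f ∈ F) (hgF : ∀ f ∈ F, f - g ∈ F) {f : RegFun p}
    (hf : f ∈ F) : f + g ∈ F := by
  have := hsymm _ (hgF _ (hsymm f hf))
  rwa [neg_sub, sub_neg_eq_add, add_comm] at this

/-- The class is unbounded in the direction of `g`, so a linear functional bounded above on it must
vanish at `g`. -/
lemma nsmul_mem_class (hsymm : ∀ f ∈ F, -f ∈ F) (hgF : ∀ f ∈ F, f - g ∈ F)
    (hg : g ∈ F) (k : ℕ) : (k : ℝ) • g ∈ F := by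
  induction k with
  | zero => simpa using zero_mem_class hg hgF
  | succ k ih =>
    have := add_mem_class hsymm hgF ih
    rwa [Nat.cast_succ, add_smul, one_smul]

/-- The half-difference of a feasible pair lies in the class, and the antipodal pair it generates
has the same distance and the same increment of the target. -/
lemma mem_modulusValues_iff (hconv : Convex ℝ F) (hsymm : ∀ f ∈ F, -f ∈ F) {δ : ℝ} (hδ : 0 ≤ δ)
    {r : ℝ} :
    r ∈ M.modulusValues F δ ↔ ∃ h ∈ F, 2 * ‖M.obs h‖ ≤ δ ∧ r = 2 * M.target h := by
  constructor
  · rintro ⟨f, hf, g, hg, hfg, rfl⟩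
    refine ⟨(1 / 2 : ℝ) • (g - f), half_sub_mem hconv hsymm hg hf, ?_, ?_⟩
    · rw [sqDist_eq] at hfg
      have := abs_le_of_sq_le_sq hfg hδ
      rw [map_smul, norm_smul, map_sub, norm_sub_rev]
      norm_num
      linarith [le_abs_self ‖M.obs f - M.obs g‖]
    · rw [target_smul, target_sub]; ring
  · rintro ⟨h, hh, hδ', rfl⟩
    refine ⟨-h, hsymm h hh, h, hh, ?_, by rw [target_neg]; ring⟩
    rw [sqDist_eq, map_neg]
    have : ‖-M.obs h - M.obs h‖ = 2 * ‖M.obs h‖ := by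
      rw [← neg_add', norm_neg, ← two_smul ℝ, norm_smul]; norm_num
    rw [this]
    gcongr

/-- Finiteness at one positive radius gives finiteness at all: shrinking by `t` carries the radius
`δ + δ'` to `δ`, and the sum in the denominator keeps `t ≤ 1`. -/
lemma bddAbove_modulusValues (hconv : Convex ℝ F) (hsymm : ∀ f ∈ F, -f ∈ F)
    (h0 : (0 : RegFun p) ∈ F) {δ : ℝ} (hδ : 0 < δ) (hb : BddAbove (M.modulusValues F δ)) {δ' : ℝ}
    (hδ' : 0 ≤ δ') : BddAbove (M.modulusValues F δ') := by
  obtain ⟨B, hB⟩ := hb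
  set t : ℝ := δ / (δ + δ') with ht
  have hpos : 0 < δ + δ' := by linarith
  have ht0 : 0 < t := div_pos hδ hpos
  have ht1 : t ≤ 1 := (div_le_one hpos).2 (by linarith)
  refine ⟨B / t, fun r hr => ?_⟩
  obtain ⟨h, hh, hn, rfl⟩ := (mem_modulusValues_iff hconv hsymm hδ').1 hr
  have := hB ((mem_modulusValues_iff hconv hsymm hδ.le).2
    ⟨t • h, smul_mem_class hconv h0 hh ht0.le ht1, ?_, rfl⟩)
  · rw [target_smul] at this
    rw [le_div_iff₀ ht0]; linarith
  · rw [map_smul, norm_smul, Real.norm_of_nonneg ht0.le]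
    have h1 : t * (2 * ‖M.obs h‖) ≤ t * (δ + δ') := by gcongr; linarith
    have h2 : t * (δ + δ') = δ := div_mul_cancel₀ _ hpos.ne'
    linarith

/-- The standing assumptions under which the modulus is a finite, nondecreasing, star-shaped
function on `[0, ∞)`. -/
structure Regular (M : Design n p) (F : Set (RegFun p)) : Prop where
  conv : Convex ℝ F
  symm : ∀ f ∈ F, -f ∈ F
  zero : (0 : RegFun p) ∈ F
  bdd : ∀ δ, 0 ≤ δ → BddAbove (M.modulusValues F δ)

/-! ### Order, scaling and supergradients of the modulus -/

namespace Regular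

variable (R : Regular M F)
include R

lemma le_modulus {h : RegFun p} (hh : h ∈ F) {δ : ℝ} (hδ : 2 * ‖M.obs h‖ ≤ δ) :
    2 * M.target h ≤ M.modulus F δ := by
  have h0 : 0 ≤ δ := by linarith [norm_nonneg (M.obs h)]
  exact le_csSup (R.bdd δ h0) ((mem_modulusValues_iff R.conv R.symm h0).2 ⟨h, hh, hδ, rfl⟩)

lemma modulus_le {δ B : ℝ} (hδ : 0 ≤ δ)
    (h : ∀ h ∈ F, 2 * ‖M.obs h‖ ≤ δ → 2 * M.target h ≤ B) : M.modulus F δ ≤ B := by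
  refine csSup_le ⟨0, (mem_modulusValues_iff R.conv R.symm hδ).2
    ⟨0, R.zero, by simpa using hδ, by simp [target_zero]⟩⟩ fun r hr => ?_
  obtain ⟨f, hf, hn, rfl⟩ := (mem_modulusValues_iff R.conv R.symm hδ).1 hr
  exact h f hf hn

lemma exists_gt_of_lt_modulus {δ B : ℝ} (hδ : 0 ≤ δ) (h : B < M.modulus F δ) :
    ∃ h ∈ F, 2 * ‖M.obs h‖ ≤ δ ∧ B < 2 * M.target h := by
  by_contra! hc
  exact absurd (R.modulus_le hδ hc) (not_le.2 h)

lemma modulus_nonneg {δ : ℝ} (hδ : 0 ≤ δ) : 0 ≤ M.modulus F δ := by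
  have := R.le_modulus R.zero (δ := δ) (by simpa using hδ)
  simpa [target_zero] using this

lemma modulus_mono {s t : ℝ} (hs : 0 ≤ s) (hst : s ≤ t) : M.modulus F s ≤ M.modulus F t :=
  R.modulus_le hs fun _ hh hn => R.le_modulus hh (hn.trans hst)

/-- Scaling an element of the class by `t` scales its norm and its target alike. This
star-shapedness is the only part of the concavity of ω that the universal bound uses. -/
lemma mul_modulus_le {t δ : ℝ} (ht0 : 0 ≤ t) (ht1 : t ≤ 1) (hδ : 0 ≤ δ) :
    t * M.modulus F δ ≤ M.modulus F (t * δ) := by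
  rcases ht0.eq_or_lt with rfl | ht
  · simpa using R.modulus_nonneg le_rfl
  rw [mul_comm, ← le_div_iff₀ ht]
  refine R.modulus_le hδ fun h hh hn => ?_
  rw [le_div_iff₀ ht]
  have := R.le_modulus (smul_mem_class R.conv R.zero hh ht0 ht1) (δ := t * δ) (by
    rw [map_smul, norm_smul, Real.norm_of_nonneg ht0]
    nlinarith)
  rw [target_smul] at this
  linarith

lemma modulus_pos (hL : ∃ f ∈ F, M.target f ≠ 0) {δ : ℝ} (hδ : 0 < δ) : 0 < M.modulus F δ := by
  obtain ⟨f, hf, hfL⟩ := hL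
  obtain ⟨f, hf, hfL⟩ : ∃ f ∈ F, 0 < M.target f := by
    rcases hfL.lt_or_gt with h | h
    · exact ⟨-f, R.symm f hf, by rw [target_neg]; linarith⟩
    · exact ⟨f, hf, h⟩
  set t : ℝ := δ / (δ + 2 * ‖M.obs f‖) with ht
  have hpos : 0 < δ + 2 * ‖M.obs f‖ := by positivity
  have ht0 : 0 < t := div_pos hδ hpos
  have ht1 : t ≤ 1 := (div_le_one hpos).2 (by linarith [norm_nonneg (M.obs f)])
  have h2 : t * (δ + 2 * ‖M.obs f‖) = δ := div_mul_cancel₀ _ hpos.ne'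
  have := R.le_modulus (smul_mem_class R.conv R.zero hf ht0.le ht1) (δ := δ) (by
    rw [map_smul, norm_smul, Real.norm_of_nonneg ht0.le]
    nlinarith [mul_pos ht0 hδ])
  rw [target_smul] at this
  exact lt_of_lt_of_le (by positivity) this

lemma supergradient_nonneg {δ c : ℝ} (hδ : 0 ≤ δ) (hc : IsSupergradient (M.modulus F) δ c) :
    0 ≤ c := by
  have h1 := hc (δ + 1) (by linarith)
  have h2 := R.modulus_mono hδ (by linarith : δ ≤ δ + 1)
  linarith

lemma supergradient_mul_le {δ c : ℝ} (hc : IsSupergradient (M.modulus F) δ c) :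
    δ * c ≤ M.modulus F δ := by
  have h1 := hc 0 le_rfl
  have h2 := R.modulus_nonneg le_rfl
  linarith

/-- A linear functional of the data whose worst-case bias `b` and norm satisfy
`b + δ ‖u‖ ≤ ω(2δ) / 2`. -/
lemma exists_optimal_weights {δ : ℝ} (hδ : 0 < δ) :
    ∃ u : EuclideanSpace ℝ (Fin n), ∀ f ∈ F,
      M.target f - ⟪u, M.obs f⟫ + δ * ‖u‖ ≤ M.modulus F (2 * δ) / 2 := by
  set ρ := M.modulus F (2 * δ) / 2 with hρ
  have hρ0 : 0 ≤ ρ := by have := R.modulus_nonneg (δ := 2 * δ) (by linarith); positivity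
  set A : Set (EuclideanSpace ℝ (Fin n) × ℝ) := (fun f => (M.obs f, M.target f)) '' F with hA
  have hAconv : Convex ℝ A := by
    rintro _ ⟨f, hf, rfl⟩ _ ⟨h, hh, rfl⟩ a b ha hb hab
    refine ⟨a • f + b • h, R.conv hf hh ha hb hab, ?_⟩
    simp [target_add, target_smul]
  -- By definition of ω(2δ), no element of norm below `δ` has target above `ρ`, so this open convex
  -- set misses the image of the class and can be separated from it.
  set B : Set (EuclideanSpace ℝ (Fin n) × ℝ) := Metric.ball 0 δ ×ˢ Set.Ioi ρ with hB
  have hBconv : Convex ℝ B := (convex_ball 0 δ).prod (convex_Ioi ρ)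
  have hBopen : IsOpen B := Metric.isOpen_ball.prod isOpen_Ioi
  have hdisj : Disjoint B A := by
    rw [Set.disjoint_left]
    rintro _ ⟨h1, h2⟩ ⟨f, hf, rfl⟩
    rw [mem_ball_zero_iff] at h1
    have := R.le_modulus hf (δ := 2 * δ) (by linarith)
    have h2 : ρ < M.target f := h2
    linarith
  obtain ⟨φ, s, hφB, hφA⟩ := geometric_hahn_banach_open hBconv hBopen hAconv hdisj
  set ψ : StrongDual ℝ (EuclideanSpace ℝ (Fin n)) := φ.comp (ContinuousLinearMap.inl ℝ _ ℝ) with hψ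
  set κ : ℝ := -φ (0, 1) with hκ
  have hφ : ∀ v r, φ (v, r) = ψ v - κ * r := by
    intro v r
    have : (v, r) = ContinuousLinearMap.inl ℝ _ ℝ v + r • ((0 : EuclideanSpace ℝ (Fin n)), (1 : ℝ)) := by
      simp
    rw [this, map_add, map_smul, hψ, hκ]
    simp; ring
  have hs0 : s ≤ 0 := by
    have := hφA (M.obs 0, M.target 0) ⟨0, R.zero, rfl⟩
    rw [map_zero, target_zero] at this
    exact this.trans_eq (map_zero φ)
  -- The separating hyperplane is not vertical, since it has the point (0, ρ + 1) of `B` strictly on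
  -- one side and the origin on the other. Its slope is then the weight vector `u`.
  have hκ0 : 0 < κ := by
    have h1 : ((0 : EuclideanSpace ℝ (Fin n)), ρ + 1) ∈ B := by simp [hB, hδ]
    have := hφB _ h1
    rw [hφ, map_zero] at this
    by_contra! hc
    nlinarith
  set u := (InnerProductSpace.toDual ℝ (EuclideanSpace ℝ (Fin n))).symm (κ⁻¹ • ψ) with hu
  have huψ : ∀ v, ψ v = κ * ⟪u, v⟫ := by
    intro v
    rw [hu, InnerProductSpace.toDual_symm_apply]
    simp [hκ0.ne']
  have hball : ∀ v, ‖v‖ < δ → κ * ⟪u, v⟫ - κ * ρ ≤ s := by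
    intro v hv
    have : ∀ ε > 0, κ * ⟪u, v⟫ - κ * ρ ≤ s + ε := by
      intro ε hε
      have h1 : (v, ρ + ε / κ) ∈ B :=
        ⟨by simpa using hv, by simpa using div_pos hε hκ0⟩
      have h2 := hφB _ h1
      rw [hφ, huψ, mul_add, mul_div_cancel₀ _ hκ0.ne'] at h2
      linarith
    exact le_of_forall_pos_le_add this
  -- The supremum of ⟪u, v⟫ over the open ball is δ‖u‖, approached by multiples of `u`.
  have hnorm : δ * ‖u‖ * κ ≤ s + κ * ρ := by
    rcases eq_or_ne u 0 with h0 | h0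
    · have := hball 0 (by simpa using hδ)
      rw [inner_zero_right] at this
      rw [h0, norm_zero]; linarith
    have hup : 0 < ‖u‖ := norm_pos_iff.2 h0
    refine le_of_forall_mul_le fun t ht => ?_
    have := hball ((t * δ / ‖u‖) • u) (by
      rw [norm_smul, Real.norm_of_nonneg (by have := ht.1; positivity), div_mul_cancel₀ _ hup.ne']
      nlinarith [ht.2])
    rw [inner_smul_right, real_inner_self_eq_norm_sq] at this
    have h3 : κ * (t * δ / ‖u‖ * ‖u‖ ^ 2) = t * (δ * ‖u‖ * κ) := by field_simp
    linarith
  refine ⟨u, fun f hf => ?_⟩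
  have h1 := hφA _ ⟨f, hf, rfl⟩
  rw [hφ, huψ] at h1
  refine le_of_mul_le_mul_left ?_ hκ0
  nlinarith

/-- The worst-case bias of the optimal estimator. -/
lemma inner_sub_target_le {δ c : ℝ} (hδ : 0 < δ) (hc : IsSupergradient (M.modulus F) δ c)
    {fs : RegFun p} (hfs : fs ∈ F) (hn : 2 * ‖M.obs fs‖ = δ)
    (hω : 2 * M.target fs = M.modulus F δ) {f : RegFun p} (hf : f ∈ F) :
    ⟪(c / δ) • ((2 : ℝ) • M.obs fs), M.obs f⟫ - M.target f ≤ (M.modulus F δ - δ * c) / 2 := by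
  have hc0 := R.supergradient_nonneg hδ.le hc
  set ω := M.modulus F δ
  set P := ⟪M.obs fs, M.obs f⟫ with hP
  set N := ‖M.obs f‖ ^ 2 with hN
  -- First-order optimality of `fs`: move from `fs` towards `-f` inside the class and compare target
  -- and norm through the supergradient inequality.
  have key : -ω - 2 * M.target f + c * δ + 4 * c * P / δ ≤ 0 := by
    refine nonpos_of_forall_le_mul (y := c / (2 * δ) * (δ ^ 2 + 8 * P + 4 * N)) fun t ht => ?_
    set h := (1 - t) • fs + t • (-f) with hh
    have hmem : h ∈ F := R.conv hfs (R.symm f hf) (by linarith [ht.2]) ht.1.le (by ring)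
    have h1 := R.le_modulus hmem le_rfl
    have h2 := hc (2 * ‖M.obs h‖) (by positivity)
    -- The tangent to the square root at δ² replaces the norm by its square, which is polynomial in
    -- `t`.
    have h3 : 2 * ‖M.obs h‖ - δ ≤ (4 * ‖M.obs h‖ ^ 2 - δ ^ 2) / (2 * δ) := by
      rw [le_div_iff₀ (by positivity)]
      nlinarith [sq_nonneg (2 * ‖M.obs h‖ - δ)]
    have h4 : 4 * ‖M.obs h‖ ^ 2 = (1 - t) ^ 2 * δ ^ 2 - 8 * (t * (1 - t)) * P + 4 * t ^ 2 * N := by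
      rw [hh, map_add, map_smul, map_smul, map_neg, norm_add_sq_real, norm_smul, norm_smul,
        inner_smul_left, inner_smul_right, inner_neg_right, norm_neg, ← hn, ← hP, mul_pow, mul_pow]
      simp only [Real.norm_eq_abs, sq_abs, conj_trivial, hN]
      ring
    have h5 : M.target h = (1 - t) * M.target fs - t * M.target f := by
      rw [hh, target_add, target_smul, target_smul, target_neg]; ring
    have h6 := mul_le_mul_of_nonneg_left h3 hc0
    rw [h4] at h6
    have h7 : c * (((1 - t) ^ 2 * δ ^ 2 - 8 * (t * (1 - t)) * P + 4 * t ^ 2 * N - δ ^ 2) / (2 * δ))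
        = t * (c / (2 * δ) * (t * (δ ^ 2 + 8 * P + 4 * N)) - (c * δ + 4 * c * P / δ)) := by
      field_simp; ring
    rw [h7] at h6
    have h8 : t * (-ω - 2 * M.target f + c * δ + 4 * c * P / δ)
        ≤ t * (t * (c / (2 * δ) * (δ ^ 2 + 8 * P + 4 * N))) := by
      have : 2 * M.target h = (1 - t) * ω - 2 * t * M.target f := by rw [h5, ← hω]; ring
      nlinarith
    exact le_of_mul_le_mul_left h8 ht.1
  rw [inner_smul_left, inner_smul_left, ← hP]
  simp only [conj_trivial]
  have h9 : 4 * c * P / δ = 2 * (c / δ * (2 * P)) := by ring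
  rw [h9] at key
  linarith

end Regular
end Design
namespace Design
open scoped RealInnerProductSpace

variable {n p : ℕ} {M : Design n p} {F : Set (RegFun p)} {g : RegFun p}

/-! ### One-sided confidence intervals -/

/-- The lower confidence limit based on the linear statistic with standardized weights `u` whose
worst-case bias is at most `b`. -/
noncomputable def lowerLimit (M : Design n p) (α : ℝ) (u : EuclideanSpace ℝ (Fin n)) (b : ℝ)
    (y : Fin n → ℝ) : ℝ :=
  ⟪u, M.scale y⟫ - b - z (1 - α) * ‖u‖

/-- The bias is linear in `f` and bounded by `b` at every k g and -k g, hence is zero at `g`. -/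
lemma inner_obs_eq_target {u : EuclideanSpace ℝ (Fin n)} {b : ℝ} (hsymm : ∀ f ∈ F, -f ∈ F)
    (hg : g ∈ F) (hgF : ∀ f ∈ F, f - g ∈ F)
    (hb : ∀ f ∈ F, ⟪u, M.obs f⟫ - M.target f ≤ b) : ⟪u, M.obs g⟫ = M.target g := by
  by_contra hne
  set x := ⟪u, M.obs g⟫ - M.target g with hx
  have hx0 : 0 < |x| := abs_pos.2 (sub_ne_zero.2 hne)
  obtain ⟨k, hk⟩ := exists_nat_gt (b / |x|)
  rw [div_lt_iff₀ hx0] at hk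
  have hkF := nsmul_mem_class hsymm hgF hg k
  have h1 := hb _ hkF
  have h2 := hb _ (hsymm _ hkF)
  rw [map_smul, inner_smul_right, target_smul] at h1
  rw [map_neg, map_smul, inner_neg_right, inner_smul_right, target_neg, target_smul] at h2
  rcases abs_cases x with h | h <;> nlinarith

lemma law_map_target_sub_lowerLimit (α b : ℝ) (u : EuclideanSpace ℝ (Fin n)) (f : RegFun p) :
    (M.law f).map (fun y => M.target f - M.lowerLimit α u b y)
      = gaussianReal (M.target f - ⟪u, M.obs f⟫ + b + z (1 - α) * ‖u‖) (‖u‖ ^ 2).toNNReal := by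
  have h : (fun y => M.target f - M.lowerLimit α u b y)
      = (fun t => (M.target f + b + z (1 - α) * ‖u‖) - t) ∘ fun y => ⟪u, M.scale y⟫ := by
    ext y; simp only [lowerLimit, Function.comp]; ring
  have hm : Measurable fun y => ⟪u, M.scale y⟫ := by simpa using M.measurable_inner_scale u 0
  rw [h, ← Measure.map_map (by fun_prop) hm, law_map_inner, gaussianReal_map_const_sub]
  congr 1; ring

lemma excessQuantile_singleton (β : ℝ) (chat : (Fin n → ℝ) → ℝ) (g : RegFun p) :
    M.excessQuantile β chat {g} = quantile ((M.law g).map fun y => M.target g - chat y) β := by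
  simp [excessQuantile]

lemma excessQuantile_lowerLimit {α β b : ℝ} (hβ : β ∈ Set.Ioo (0 : ℝ) 1)
    {u : EuclideanSpace ℝ (Fin n)} (hug : ⟪u, M.obs g⟫ = M.target g) :
    M.excessQuantile β (M.lowerLimit α u b) {g} = b + (z β + z (1 - α)) * ‖u‖ := by
  rw [excessQuantile_singleton, law_map_target_sub_lowerLimit,
    quantile_gaussianReal (norm_nonneg u) hβ.1 hβ.2, hug]
  ring

lemma isConfSet_lowerLimit {α b : ℝ} (hα : α ∈ Set.Ioo (0 : ℝ) 1)
    {u : EuclideanSpace ℝ (Fin n)} (hb : ∀ f ∈ F, ⟪u, M.obs f⟫ - M.target f ≤ b) :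
    M.IsConfSet F α fun y => Set.Ici (M.lowerLimit α u b y) := by
  have hm : Measurable (M.lowerLimit α u b) := by
    have := M.measurable_scale
    unfold lowerLimit; fun_prop
  refine ⟨measurableSet_le (hm.comp measurable_fst) measurable_snd, ?_⟩
  refine le_iInf₂ fun f hf => ?_
  have h1 : M.law f {y | M.target f ∈ Set.Ici (M.lowerLimit α u b y)}
      = ((M.law f).map (fun y => M.target f - M.lowerLimit α u b y)) (Set.Ici 0) := by
    rw [Measure.map_apply (by fun_prop) measurableSet_Ici]
    congr 1; ext y; simp
  rw [h1, law_map_target_sub_lowerLimit]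
  rcases eq_or_ne u 0 with h0 | h0
  · have h2 := hb f hf
    rw [h0, inner_zero_left] at h2
    have h3 : (‖u‖ ^ 2).toNNReal = 0 := by simp [h0]
    rw [h3, gaussianReal_zero_var, Measure.dirac_apply' _ measurableSet_Ici, Set.indicator_of_mem]
    · simpa using hα.1.le
    · simp only [Set.mem_Ici, h0, inner_zero_left, norm_zero]; linarith
  · have hpos : 0 < ‖u‖ := norm_pos_iff.2 h0
    rw [gaussianReal_Ici hpos]
    refine ENNReal.ofReal_le_ofReal ?_
    rw [← z_le_iff (by linarith [hα.2]) (by linarith [hα.1]), le_div_iff₀ hpos]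
    linarith [hb f hf]

lemma measurable_of_measurableSet_Ici {chat : (Fin n → ℝ) → ℝ}
    (h : MeasurableSet {q : (Fin n → ℝ) × ℝ | q.2 ∈ Set.Ici (chat q.1)}) : Measurable chat :=
  measurable_of_Iic fun t => (measurable_prodMk_right (y := t)) h

namespace Regular

variable (R : Regular M F)
include R

/-- If the excess quantile `q` were below L h, then with probability at least β under `g` the
interval would miss L(g - h). Neyman–Pearson caps that probability at Φ(‖h‖ - z_{1-α}), which forces
‖h‖ ≥ z_β + z_{1-α}. -/
lemma half_modulus_le_excessQuantile (hgF : ∀ f ∈ F, f - g ∈ F) {α β : ℝ}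
    (hα : α ∈ Set.Ioo (0 : ℝ) 1) (hβ : β ∈ Set.Ioo (0 : ℝ) 1) (hδ : 0 < z β + z (1 - α))
    {chat : (Fin n → ℝ) → ℝ} (hC : M.IsConfSet F α fun y => Set.Ici (chat y)) :
    M.modulus F (2 * (z β + z (1 - α))) / 2 ≤ M.excessQuantile β chat {g} := by
  have hm := measurable_of_measurableSet_Ici hC.1
  set q := M.excessQuantile β chat {g} with hq
  have hmap : Measurable fun y => M.target g - chat y := by fun_prop
  have : IsProbabilityMeasure ((M.law g).map fun y => M.target g - chat y) :=
    Measure.isProbabilityMeasure_map hmap.aemeasurable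
  have hle := le_measure_Iic_quantile ((M.law g).map fun y => M.target g - chat y) hβ.2
  rw [← excessQuantile_singleton, ← hq, Measure.map_apply hmap measurableSet_Iic] at hle
  have key : ∀ h ∈ F, ‖M.obs h‖ < z β + z (1 - α) → M.target h ≤ q := by
    intro h hh hn
    by_contra! hlt
    have hf : g - h ∈ F := by
      have := add_mem_class R.symm hgF (R.symm h hh)
      rwa [neg_add_eq_sub] at this
    set S := {y : Fin n → ℝ | M.target (g - h) ∈ Set.Ici (chat y)} with hS
    have hSm : MeasurableSet S := measurableSet_le hm measurable_const
    have h1 := M.law_ge_of_law_ge hα (g - h) g hSm (hC.2.trans (iInf₂_le _ hf))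
    have h2 : (fun y => M.target g - chat y) ⁻¹' Set.Iic q ⊆ Sᶜ := by
      intro y hy
      simp only [Set.mem_preimage, Set.mem_Iic] at hy
      simp only [hS, Set.mem_compl_iff, Set.mem_ofPred_eq, Set.mem_Ici, not_le, target_sub]
      linarith
    have h3 := hle.trans (measure_mono h2)
    rw [prob_compl_eq_one_sub hSm] at h3
    have h4 : ENNReal.ofReal β ≤ ENNReal.ofReal (1 - Phi (z (1 - α) - ‖M.obs h‖)) := by
      rw [ENNReal.ofReal_sub _ (Phi_nonneg _), ENNReal.ofReal_one]
      refine h3.trans (tsub_le_tsub_left ?_ _)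
      simpa using h1
    rw [ENNReal.ofReal_le_ofReal_iff (by linarith [Phi_le_one (z (1 - α) - ‖M.obs h‖)]),
      ← Phi_neg, ← z_le_iff hβ.1 hβ.2] at h4
    linarith
  have h5 : M.modulus F (2 * (z β + z (1 - α))) ≤ 2 * q := by
    refine R.modulus_le (by linarith) fun h hh hn => ?_
    -- The contradiction needs a strict norm bound, so `h` is shrunk slightly and t → 1.
    have : M.target h ≤ q := le_of_forall_mul_le fun t ht => by
      rw [← target_smul]
      refine key _ (smul_mem_class R.conv R.zero hh ht.1.le ht.2.le) ?_
      rw [map_smul, norm_smul, Real.norm_of_nonneg ht.1.le]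
      nlinarith [ht.1, ht.2, norm_nonneg (M.obs h)]
    linarith
  linarith

lemma bestExcessQuantile_eq (hg : g ∈ F) (hgF : ∀ f ∈ F, f - g ∈ F) {α β : ℝ}
    (hα : α ∈ Set.Ioo (0 : ℝ) 1) (hβ : β ∈ Set.Ioo (0 : ℝ) 1) (hδ : 0 < z β + z (1 - α)) :
    M.bestExcessQuantile F α β {g} = M.modulus F (2 * (z β + z (1 - α))) / 2 := by
  obtain ⟨u, hu⟩ := R.exists_optimal_weights hδ
  set b := M.modulus F (2 * (z β + z (1 - α))) / 2 - (z β + z (1 - α)) * ‖u‖ with hb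
  have hub : ∀ f ∈ F, ⟪u, M.obs f⟫ - M.target f ≤ b := fun f hf => by
    have := hu _ (R.symm f hf)
    rw [map_neg, inner_neg_right, target_neg] at this
    linarith
  have hmem : M.modulus F (2 * (z β + z (1 - α))) / 2 ∈ {q | ∃ chat : (Fin n → ℝ) → ℝ,
      M.IsConfSet F α (fun y => Set.Ici (chat y)) ∧ q = M.excessQuantile β chat {g}} :=
    ⟨M.lowerLimit α u b, isConfSet_lowerLimit hα hub, by
      rw [excessQuantile_lowerLimit hβ (inner_obs_eq_target R.symm hg hgF hub), hb]; ring⟩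
  refine IsLeast.csInf_eq ⟨hmem, ?_⟩
  rintro q ⟨chat, hC, rfl⟩
  exact R.half_modulus_le_excessQuantile hgF hα hβ hδ hC

end Regular

/-! ### The estimator built from a solution of the modulus problem -/

variable (M) in
/-- The standardized weights of `L̂_δ`. -/
noncomputable def stdWeights (δ c : ℝ) (fs : RegFun p) : EuclideanSpace ℝ (Fin n) :=
  (c / δ) • ((2 : ℝ) • M.obs fs)

lemma optWeights_eq (δ c : ℝ) (fs : RegFun p) (i : Fin n) :
    M.optWeights δ c (-fs) fs i
      = M.stdWeights δ c fs i / Real.sqrt (M.var (M.x i) (M.d i)) := by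
  simp only [optWeights, stdWeights, PiLp.smul_apply, obs_apply, smul_eq_mul, Pi.neg_apply]
  rw [mul_div_assoc, mul_div_assoc, div_div, ← sq, sq_sqrt_var]
  ring

/-- The centering constant vanishes because the two functions of the pair sum to zero. -/
lemma optEst_eq (δ c : ℝ) (fs : RegFun p) (y : Fin n → ℝ) :
    M.optEst δ c (-fs) fs y = ⟪M.stdWeights δ c fs, M.scale y⟫ := by
  have h : M.optCenter δ c (-fs) fs = 0 := by
    simp [optCenter, target_zero]
  simp only [optEst, affineEst, h, zero_add, optWeights_eq, PiLp.inner_apply, scale_apply,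
    RCLike.inner_apply, conj_trivial]
  exact Finset.sum_congr rfl fun i _ => by ring

lemma sd_optWeights (δ c : ℝ) (fs : RegFun p) :
    M.sd (M.optWeights δ c (-fs) fs) = ‖M.stdWeights δ c fs‖ := by
  rw [sd, EuclideanSpace.norm_eq]
  congr 1
  refine Finset.sum_congr rfl fun i _ => ?_
  rw [optWeights_eq, div_pow, sq_sqrt_var, Real.norm_eq_abs, sq_abs,
    div_mul_cancel₀ _ (by exact_mod_cast (M.var_pos i).ne')]

lemma bias_inner (u : EuclideanSpace ℝ (Fin n)) (f : RegFun p) :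
    M.bias (fun y => ⟪u, M.scale y⟫) f = ⟪u, M.obs f⟫ - M.target f := by
  have hm : Measurable fun y => ⟪u, M.scale y⟫ := by simpa using M.measurable_inner_scale u 0
  have h2 := M.law_map_inner f u
  have hi : Integrable (fun y => ⟪u, M.scale y⟫) (M.law f) := by
    have : Integrable (id : ℝ → ℝ) ((M.law f).map fun y => ⟪u, M.scale y⟫) := by
      rw [h2]
      exact (memLp_id_gaussianReal 1).integrable (by norm_num)
    exact (integrable_map_measure aestronglyMeasurable_id hm.aemeasurable).1 this
  rw [bias, integral_sub hi (integrable_const _)]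
  have h3 : ∫ y, ⟪u, M.scale y⟫ ∂(M.law f)
      = ∫ t, t ∂((M.law f).map fun y => ⟪u, M.scale y⟫) :=
    (integral_map (f := fun t : ℝ => t) hm.aemeasurable aestronglyMeasurable_id).symm
  rw [h3, h2, integral_id_gaussianReal]
  simp

lemma sqDist_neg_self {fs : RegFun p} :
    M.sqDist (-fs) fs = (2 * ‖M.obs fs‖) ^ 2 := by
  rw [sqDist_eq, map_neg, ← neg_add', norm_neg, ← two_smul ℝ, norm_smul]
  norm_num

lemma modulus_eq_of_attains {δ : ℝ} {fs : RegFun p} (h : M.AttainsModulus F δ (-fs) fs) :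
    2 * M.target fs = M.modulus F δ ∧ BddAbove (M.modulusValues F δ) := by
  have hmem : 2 * M.target fs ∈ M.modulusValues F δ :=
    ⟨-fs, h.1, fs, h.2.1, h.2.2.1, by rw [target_neg]; ring⟩
  have hub : ∀ r ∈ M.modulusValues F δ, r ≤ 2 * M.target fs := fun r hr => by
    have := h.2.2.2 r hr
    rw [target_neg] at this; linarith
  exact ⟨(IsGreatest.csSup_eq ⟨hmem, hub⟩).symm, ⟨_, hub⟩⟩

namespace Regular

variable (R : Regular M F)
include R

variable {δ c : ℝ} (hδ : 0 < δ) (hc : IsSupergradient (M.modulus F) δ c) {fs : RegFun p}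
  (hfs : fs ∈ F) (hn : 2 * ‖M.obs fs‖ = δ) (hω : 2 * M.target fs = M.modulus F δ)
include hδ hc hn

lemma norm_stdWeights : ‖M.stdWeights δ c fs‖ = c := by
  rw [stdWeights, norm_smul, norm_smul, Real.norm_of_nonneg
    (div_nonneg (R.supergradient_nonneg hδ.le hc) hδ.le)]
  norm_num
  rw [hn, div_mul_cancel₀ _ hδ.ne']

include hfs hω

/-- The first-order bound on the bias is attained at `-fs`. -/
lemma isGreatest_bias : IsGreatest (M.bias (M.optEst δ c (-fs) fs) '' F)
    ((M.modulus F δ - δ * c) / 2) := by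
  have h : M.optEst δ c (-fs) fs = fun y => ⟪M.stdWeights δ c fs, M.scale y⟫ :=
    funext fun y => optEst_eq δ c fs y
  rw [h]
  constructor
  · refine ⟨-fs, R.symm fs hfs, ?_⟩
    rw [bias_inner, map_neg, inner_neg_right, target_neg, stdWeights, inner_smul_left,
      inner_smul_left, real_inner_self_eq_norm_sq, ← hω]
    have : ‖M.obs fs‖ = δ / 2 := by linarith
    rw [this]
    simp only [conj_trivial]
    field_simp; ring
  · rintro _ ⟨f, hf, rfl⟩
    rw [bias_inner]
    exact R.inner_sub_target_le hδ hc hfs hn hω hf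

lemma maxBias_optEst :
    M.maxBias F (M.optEst δ c (-fs) fs) = (M.modulus F δ - δ * c) / 2 :=
  (R.isGreatest_bias hδ hc hfs hn hω).csSup_eq

lemma minBias_optEst :
    M.minBias F (M.optEst δ c (-fs) fs) = -((M.modulus F δ - δ * c) / 2) := by
  have hneg : ∀ f, M.bias (M.optEst δ c (-fs) fs) (-f) = -M.bias (M.optEst δ c (-fs) fs) f := by
    have h : M.optEst δ c (-fs) fs = fun y => ⟪M.stdWeights δ c fs, M.scale y⟫ :=
      funext fun y => optEst_eq δ c fs y
    intro f
    rw [h, bias_inner, bias_inner, map_neg, inner_neg_right, target_neg]; ring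
  obtain ⟨⟨f, hf, hfe⟩, hub⟩ := R.isGreatest_bias hδ hc hfs hn hω
  refine IsLeast.csInf_eq ⟨⟨-f, R.symm f hf, by rw [hneg, hfe]⟩, ?_⟩
  rintro _ ⟨f', hf', rfl⟩
  have := hub ⟨-f', R.symm f' hf', rfl⟩
  rw [hneg] at this
  linarith

lemma excessQuantile_optLower (hg : g ∈ F) (hgF : ∀ f ∈ F, f - g ∈ F) {α β : ℝ}
    (hβ : β ∈ Set.Ioo (0 : ℝ) 1) (hδe : δ = z β + z (1 - α)) :
    M.excessQuantile β (M.optLower F α δ c (-fs) fs) {g} = (M.modulus F δ + δ * c) / 2 := by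
  have h : M.optLower F α δ c (-fs) fs
      = M.lowerLimit α (M.stdWeights δ c fs) ((M.modulus F δ - δ * c) / 2) := by
    ext y
    rw [optLower, lowerLimit, optEst_eq, R.maxBias_optEst hδ hc hfs hn hω, sd_optWeights]
  have hug : ⟪M.stdWeights δ c fs, M.obs g⟫ = M.target g := inner_obs_eq_target R.symm hg hgF
    fun f hf => R.inner_sub_target_le hδ hc hfs hn hω hf
  rw [h, excessQuantile_lowerLimit hβ hug, R.norm_stdWeights hδ hc hn, ← hδe]
  ring

end Regular

theorem one_sided_efficiency (hconv : Convex ℝ F) (hsymm : ∀ f ∈ F, -f ∈ F) (hg : g ∈ F)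
    (hgF : ∀ f ∈ F, f - g ∈ F) {α β δ c : ℝ} (hα : α ∈ Set.Ioo (0 : ℝ) 1)
    (hL : ∃ f ∈ F, M.target f ≠ 0) (hβ : β ∈ Set.Ioo (0 : ℝ) 1) (hδe : δ = z β + z (1 - α))
    (hδ : 0 < δ) {fs : RegFun p} (hfs : M.AttainsModulus F δ (-fs) fs)
    (hn : M.sqDist (-fs) fs = δ ^ 2) (hc : IsSupergradient (M.modulus F) δ c) :
    M.bestExcessQuantile F α β {g} / M.excessQuantile β (M.optLower F α δ c (-fs) fs) {g}
        = M.modulus F (2 * δ) / (M.modulus F δ + δ * c) ∧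
      1 / 2 ≤ M.modulus F (2 * δ) / (M.modulus F δ + δ * c) := by
  obtain ⟨hω, hb⟩ := modulus_eq_of_attains hfs
  have h0 := zero_mem_class hg hgF
  -- Finiteness of the modulus is not assumed in this part; it follows from attainment at `δ`.
  have R : Regular M F := ⟨hconv, hsymm, h0, fun δ' => bddAbove_modulusValues hconv hsymm h0 hδ hb⟩
  have hn' : 2 * ‖M.obs fs‖ = δ := by
    rw [sqDist_neg_self] at hn
    exact (pow_left_inj₀ (by positivity) hδ.le two_ne_zero).1 hn
  have hpos := R.modulus_pos hL hδ
  have hc0 := R.supergradient_nonneg hδ.le hc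
  constructor
  · rw [R.excessQuantile_optLower hδ hc hfs.2.1 hn' hω hg hgF hβ hδe,
      R.bestExcessQuantile_eq hg hgF hα hβ (hδe ▸ hδ), ← hδe,
      div_div_div_cancel_right₀ two_ne_zero]
  · rw [le_div_iff₀ (by positivity)]
    have h1 := R.supergradient_mul_le hc
    have h2 := R.modulus_mono hδ.le (by linarith : δ ≤ 2 * δ)
    linarith

end Design

/-! ### Critical values -/

lemma gaussianReal_Icc {a b : ℝ} (hab : a ≤ b) :
    gaussianReal 0 1 (Set.Icc a b) = ENNReal.ofReal (Phi b - Phi a) := by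
  have := nullSingletonClass_gaussianReal (μ := 0) (v := 1) one_ne_zero
  rw [measure_congr Ioc_ae_eq_Icc.symm, ← Set.Iic_sdiff_Iic,
    measure_sdiff (Set.Iic_subset_Iic.2 hab) measurableSet_Iic.nullMeasurableSet (measure_ne_top _ _),
    ENNReal.ofReal_sub _ (Phi_nonneg _), ofReal_Phi, ofReal_Phi]

lemma gaussianPDFReal_le_one (t : ℝ) : gaussianPDFReal 0 1 t ≤ 1 := by
  rw [gaussianPDFReal]
  refine mul_le_one₀ (inv_le_one_of_one_le₀ ?_) (Real.exp_pos _).le (Real.exp_le_one_iff.2 ?_)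
  · rw [Real.one_le_sqrt]
    norm_num
    nlinarith [Real.pi_gt_three]
  · simp only [sub_zero, NNReal.coe_one, mul_one]
    linarith [sq_nonneg t]

lemma Phi_sub_le {a b : ℝ} (hab : a ≤ b) : Phi b - Phi a ≤ b - a := by
  have h := intervalIntegral.integral_mono_on (μ := volume) hab
    (continuous_gaussianPDFReal.intervalIntegrable a b)
    (intervalIntegrable_const (c := (1 : ℝ)))
    fun t _ => gaussianPDFReal_le_one t
  rw [Phi_sub]
  simpa using h

lemma gaussianReal_one_eq_map (b : ℝ) :
    gaussianReal b 1 = (gaussianReal 0 1).map (fun t => b + t) := by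
  rw [gaussianReal_map_const_add, zero_add]

lemma map_abs_Iic (b x : ℝ) :
    (gaussianReal b 1).map (fun t : ℝ => |t|) (Set.Iic x)
      = gaussianReal 0 1 (Set.Icc (-x - b) (x - b)) := by
  rw [Measure.map_apply (by fun_prop) measurableSet_Iic, gaussianReal_one_eq_map,
    Measure.map_apply (by fun_prop) (measurableSet_Iic.preimage (by fun_prop))]
  congr 1; ext t
  simp only [Set.mem_preimage, Set.mem_Iic, Set.mem_Icc, abs_le]
  constructor <;> rintro ⟨h1, h2⟩ <;> constructor <;> linarith

instance (b : ℝ) : IsProbabilityMeasure ((gaussianReal b 1).map (fun t : ℝ => |t|)) :=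
  Measure.isProbabilityMeasure_map (by fun_prop)

variable {α : ℝ} (hα : α ∈ Set.Ioo (0 : ℝ) 1)
include hα

lemma z_half_pos : 0 < z (1 - α / 2) := by
  rw [lt_z_iff (by linarith [hα.2]) (by linarith [hα.1]), Phi_zero]
  linarith [hα.2]

lemma Phi_z_half_sub : Phi (z (1 - α / 2)) - Phi (-z (1 - α / 2)) = 1 - α := by
  rw [Phi_neg, Phi_z (by linarith [hα.2]) (by linarith [hα.1])]; ring

/-- Enlarging the half-width by the bias keeps the interval of half-width z_{1-α/2} around the true
centre inside. -/
lemma cv_le_add {b : ℝ} (hb : 0 ≤ b) : cv α b ≤ b + z (1 - α / 2) := by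
  have hq := z_half_pos hα
  refine quantile_le _ (by linarith [hα.2]) ?_
  rw [map_abs_Iic, ← Phi_z_half_sub hα, ← gaussianReal_Icc (by linarith)]
  exact measure_mono (Set.Icc_subset_Icc (by linarith) (by linarith))

lemma Phi_cv (b : ℝ) : 0 ≤ cv α b ∧ 1 - α ≤ Phi (cv α b - b) - Phi (-cv α b - b) := by
  have h := le_measure_Iic_quantile ((gaussianReal b 1).map (fun t : ℝ => |t|))
    (p := 1 - α) (by linarith [hα.1])
  rw [map_abs_Iic] at h
  change ENNReal.ofReal (1 - α) ≤ gaussianReal 0 1 (Set.Icc (-cv α b - b) (cv α b - b)) at h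
  have h0 : 0 ≤ cv α b := by
    by_contra! hneg
    rw [Set.Icc_eq_empty (by linarith), measure_empty, nonpos_iff_eq_zero,
      ENNReal.ofReal_eq_zero] at h
    linarith [hα.2]
  refine ⟨h0, ?_⟩
  rwa [gaussianReal_Icc (by linarith), ENNReal.ofReal_le_ofReal_iff] at h
  linarith [Phi_mono (by linarith : -cv α b - b ≤ cv α b - b)]

/-- Two bounds are combined: cv ≥ (1 - α)/2, as the density is at most 1, and cv ≥ b + z_{1-α}. It
keeps the infimum of the interval lengths away from zero. -/
lemma exists_mul_le_cv : ∃ κ > 0, ∀ b, 0 ≤ b → κ * (1 + b) ≤ cv α b := by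
  set e := (1 - α) / 2 with he
  have he0 : 0 < e := by have := hα.2; simp only [he]; linarith
  set K := 1 + (1 + |z (1 - α)|) / e with hK
  have hK0 : 0 < K := by positivity
  refine ⟨K⁻¹, inv_pos.2 hK0, fun b hb => ?_⟩
  obtain ⟨h0, h1⟩ := Phi_cv hα b
  have h2 : e ≤ cv α b := by
    have := Phi_sub_le (by linarith : -cv α b - b ≤ cv α b - b)
    simp only [he]; linarith
  have h3 : z (1 - α) ≤ cv α b - b := by
    rw [z_le_iff (by linarith [hα.2]) (by linarith [hα.1])]
    linarith [Phi_nonneg (-cv α b - b)]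
  rw [inv_mul_le_iff₀ hK0]
  have h4 : 1 + |z (1 - α)| ≤ (1 + |z (1 - α)|) / e * cv α b := by
    rw [div_mul_eq_mul_div, le_div_iff₀ he0]
    gcongr
  have h5 : K * cv α b = cv α b + (1 + |z (1 - α)|) / e * cv α b := by rw [hK]; ring
  linarith [neg_abs_le (z (1 - α))]

omit hα

/-! ### Truncated normal moments -/

lemma hasDerivAt_gaussianPDFReal (x : ℝ) :
    HasDerivAt (gaussianPDFReal 0 1) (-x * gaussianPDFReal 0 1 x) x := by
  have h : gaussianPDFReal 0 1
      = fun x => (Real.sqrt (2 * Real.pi * (1 : ℝ≥0)))⁻¹ * Real.exp (-(x - 0) ^ 2 / (2 * (1 : ℝ≥0))) :=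
    rfl
  rw [h]
  have h1 : HasDerivAt (fun x : ℝ => -(x - 0) ^ 2 / (2 * ((1 : ℝ≥0) : ℝ))) (-x) x := by
    have := ((((hasDerivAt_id x).sub_const 0).pow 2).neg).div_const (2 * ((1 : ℝ≥0) : ℝ))
    refine this.congr_deriv ?_
    simp only [id, sub_zero, NNReal.coe_one]
    norm_num
    ring
  refine (h1.exp.const_mul _).congr_deriv ?_
  ring

lemma tendsto_gaussianPDFReal_atBot :
    Filter.Tendsto (gaussianPDFReal 0 1) Filter.atBot (nhds 0) := by
  have h1 : Filter.Tendsto (fun x : ℝ => -(x - 0) ^ 2 / (2 * ((1 : ℝ≥0) : ℝ)))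
      Filter.atBot Filter.atBot := by
    have h2 : Filter.Tendsto (fun x : ℝ => x * x) Filter.atBot Filter.atTop :=
      Filter.tendsto_id.atBot_mul_atBot₀ Filter.tendsto_id
    have h3 := (Filter.tendsto_neg_atTop_atBot.comp h2).atBot_mul_const (r := (1 / 2 : ℝ)) (by norm_num)
    refine h3.congr fun x => ?_
    simp; ring
  have := (Real.tendsto_exp_atBot.comp h1).const_mul (Real.sqrt (2 * Real.pi * (1 : ℝ≥0)))⁻¹
  rwa [mul_zero] at this

lemma integrable_id_gaussian : Integrable (fun t : ℝ => t) (gaussianReal 0 1) :=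
  (memLp_id_gaussianReal (μ := 0) (v := 1) 1).integrable (by norm_num)

lemma integrable_mul_gaussianPDFReal : Integrable fun t => t * gaussianPDFReal 0 1 t := by
  have h := integrable_id_gaussian
  rw [gaussianReal_of_var_ne_zero _ one_ne_zero, integrable_withDensity_iff
    (measurable_gaussianPDF 0 1) (Filter.Eventually.of_forall fun _ => gaussianPDF_lt_top)] at h
  simpa [toReal_gaussianPDF] using h

lemma setIntegral_gaussian_eq (x : ℝ) (f : ℝ → ℝ) :
    ∫ t in Set.Iic x, f t ∂(gaussianReal 0 1)
      = ∫ t in Set.Iic x, gaussianPDFReal 0 1 t * f t := by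
  rw [← integral_indicator measurableSet_Iic, ← integral_indicator measurableSet_Iic,
    integral_gaussianReal_eq_integral_smul one_ne_zero]
  congr 1; ext t
  by_cases h : t ∈ Set.Iic x <;> simp [h]

lemma setIntegral_id_gaussian (x : ℝ) :
    ∫ t in Set.Iic x, t ∂(gaussianReal 0 1) = -gaussianPDFReal 0 1 x := by
  rw [setIntegral_gaussian_eq]
  have h := integral_Iic_of_hasDerivAt_of_tendsto' (a := x)
    (f := gaussianPDFReal 0 1) (fun t _ => hasDerivAt_gaussianPDFReal t)
    (by
      have := integrable_mul_gaussianPDFReal.neg.integrableOn (s := Set.Iic x)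
      refine this.congr_fun (fun t _ => ?_) measurableSet_Iic
      simp)
    tendsto_gaussianPDFReal_atBot
  rw [sub_zero] at h
  rw [← h, ← integral_neg]
  congr 1; ext t; ring

lemma setIntegral_const_sub_gaussian (x : ℝ) :
    ∫ t in Set.Iic x, (x - t) ∂(gaussianReal 0 1) = x * Phi x + gaussianPDFReal 0 1 x := by
  rw [integral_sub (integrable_const _) integrable_id_gaussian.integrableOn,
    setIntegral_id_gaussian, setIntegral_const, ← Phi_eq_real, smul_eq_mul]
  ring

lemma setIntegral_min_gaussian {x q : ℝ} (hq : 0 ≤ q) :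
    ∫ t in Set.Iic x, min (x - t) q ∂(gaussianReal 0 1)
      = x * Phi x + gaussianPDFReal 0 1 x
        - ((x - q) * Phi (x - q) + gaussianPDFReal 0 1 (x - q)) := by
  have hi : ∀ c : ℝ, Integrable (fun t => c - t) (gaussianReal 0 1) :=
    fun c => (integrable_const c).sub integrable_id_gaussian
  -- On t ≤ x, the capped ramp is the difference of the positive parts of x - t and x - q - t.
  have h1 : ∀ t, min (x - t) q = (x - t) - (Set.Iic (x - q)).indicator (fun t => x - q - t) t := by
    intro t
    by_cases h : t ≤ x - q
    · rw [Set.indicator_of_mem (Set.mem_Iic.2 h), min_eq_right (by linarith)]; ring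
    · rw [Set.indicator_of_notMem (by simpa using h), min_eq_left (by linarith), sub_zero]
  simp_rw [h1]
  rw [integral_sub (hi x).integrableOn
    ((hi (x - q)).indicator measurableSet_Iic).integrableOn,
    setIntegral_indicator measurableSet_Iic, Set.Iic_inter_Iic, min_eq_right (by linarith),
    setIntegral_const_sub_gaussian, setIntegral_const_sub_gaussian]

namespace Design
namespace Regular

variable {n p : ℕ} {M : Design n p} {F : Set (RegFun p)} (R : Regular M F)
include R

/-! ### Length of fixed-length confidence intervals -/

/-- The target takes every real value on the class, so ω is unbounded, whereas a nonpositive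
supergradient would bound it by its value at `δ`. -/
lemma supergradient_pos (hL : ∀ L₀ : ℝ, ∃ f ∈ F, M.target f = L₀) {δ c : ℝ} (hδ : 0 ≤ δ)
    (hc : IsSupergradient (M.modulus F) δ c) : 0 < c := by
  by_contra! hneg
  obtain ⟨f, hf, hfL⟩ := hL (M.modulus F δ + 1)
  have hω := R.modulus_nonneg hδ
  set t := max (2 * ‖M.obs f‖) δ
  have ht : δ ≤ t := le_max_right _ _
  have h1 := hc t (by linarith)
  have h2 : _ ≤ M.modulus F t := R.le_modulus hf (le_max_left _ δ)
  nlinarith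

/-- At this particular δ the terms in ω'(δ) cancel once cv_α(b) is replaced by b + z_{1-α/2}. -/
lemma flciLength_le {α : ℝ} (hα : α ∈ Set.Ioo (0 : ℝ) 1) {ω' : ℝ → ℝ} {δ : ℝ}
    (hs : 0 < ω' δ) (hc : IsSupergradient (M.modulus F) δ (ω' δ)) (hδ : δ = 2 * z (1 - α / 2)) :
    M.flciLength F α ω' δ ≤ M.modulus F δ := by
  have hb := R.supergradient_mul_le hc
  have h0 : 0 ≤ M.modulus F δ / (2 * ω' δ) - δ / 2 := by
    rw [sub_nonneg, div_le_div_iff₀ two_pos (by positivity)]; linarith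
  have h1 := cv_le_add hα h0
  rw [flciLength]
  calc 2 * cv α (M.modulus F δ / (2 * ω' δ) - δ / 2) * ω' δ
      ≤ 2 * (M.modulus F δ / (2 * ω' δ) - δ / 2 + z (1 - α / 2)) * ω' δ := by gcongr
    _ = M.modulus F δ := by
      have hq : z (1 - α / 2) = δ / 2 := by linarith
      rw [hq]; field_simp; ring

/-- With the linear lower bound for cv, the length dominates a multiple of the supporting line of ω
at δ evaluated at 1, hence of ω(1), uniformly in δ. -/
lemma exists_le_flciLength {α : ℝ} (hα : α ∈ Set.Ioo (0 : ℝ) 1) (hL : ∃ f ∈ F, M.target f ≠ 0) :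
    ∃ ε > 0, ∀ (ω' : ℝ → ℝ) (δ : ℝ), 0 < ω' δ →
      IsSupergradient (M.modulus F) δ (ω' δ) → ε ≤ M.flciLength F α ω' δ := by
  obtain ⟨κ, hκ, hcv⟩ := exists_mul_le_cv hα
  have h1 := R.modulus_pos hL one_pos
  refine ⟨κ * M.modulus F 1, by positivity, fun ω' δ hs hc => ?_⟩
  have hb := R.supergradient_mul_le hc
  have h0 : 0 ≤ M.modulus F δ / (2 * ω' δ) - δ / 2 := by
    rw [sub_nonneg, div_le_div_iff₀ two_pos (by positivity)]; linarith
  have h2 := hcv _ h0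
  have h3 := hc 1 zero_le_one
  rw [flciLength]
  calc κ * M.modulus F 1 ≤ κ * (M.modulus F δ + 2 * ω' δ - δ * ω' δ) := by gcongr; linarith
    _ = 2 * (κ * (1 + (M.modulus F δ / (2 * ω' δ) - δ / 2))) * ω' δ := by field_simp; ring
    _ ≤ _ := by gcongr

lemma iInf_flciLength_pos {α : ℝ} (hα : α ∈ Set.Ioo (0 : ℝ) 1)
    (hL : ∀ L₀ : ℝ, ∃ f ∈ F, M.target f = L₀) {ω' : ℝ → ℝ}
    (hω' : ∀ δ, 0 < δ → IsSupergradient (M.modulus F) δ (ω' δ)) :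
    0 < (⨅ δ : Set.Ioi (0 : ℝ), M.flciLength F α ω' δ) ∧
      (⨅ δ : Set.Ioi (0 : ℝ), M.flciLength F α ω' δ) ≤ M.modulus F (2 * z (1 - α / 2)) := by
  have hne : ∃ f ∈ F, M.target f ≠ 0 := by
    obtain ⟨f, hf, h⟩ := hL 1
    exact ⟨f, hf, by rw [h]; exact one_ne_zero⟩
  obtain ⟨ε, hε, h⟩ := R.exists_le_flciLength hα hne
  have hpos : ∀ δ, 0 < δ → 0 < ω' δ := fun δ hδ => R.supergradient_pos hL hδ.le (hω' δ hδ)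
  have hle : ∀ δ : Set.Ioi (0 : ℝ), ε ≤ M.flciLength F α ω' δ :=
    fun δ => h ω' δ (hpos δ δ.2) (hω' δ δ.2)
  have hq := z_half_pos hα
  have hq2 : 0 < 2 * z (1 - α / 2) := by positivity
  have : Nonempty (Set.Ioi (0 : ℝ)) := ⟨⟨1, Set.mem_Ioi.2 one_pos⟩⟩
  have hbdd : BddBelow (Set.range fun δ : Set.Ioi (0 : ℝ) => M.flciLength F α ω' δ) :=
    ⟨ε, Set.forall_mem_range.2 hle⟩
  refine ⟨hε.trans_le (le_ciInf hle), ?_⟩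
  have h1 := ciInf_le hbdd ⟨2 * z (1 - α / 2), Set.mem_Ioi.2 hq2⟩
  exact h1.trans (R.flciLength_le hα (hpos _ hq2) (hω' _ hq2) rfl)

omit R in
lemma adaptLength_eq {α : ℝ} (hα : α ∈ Set.Ioo (0 : ℝ) 1) :
    M.adaptLength F α
      = ∫ t in Set.Iic (z (1 - α)), M.modulus F (2 * (z (1 - α) - t)) ∂(gaussianReal 0 1) := by
  have hz : Phi (z (1 - α)) = 1 - α := Phi_z (by linarith [hα.2]) (by linarith [hα.1])
  have h1 : (1 - α) ≠ 0 := by linarith [hα.2]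
  rw [adaptLength, ProbabilityTheory.cond, integral_smul_measure, ← ofReal_Phi, hz,
    ENNReal.toReal_inv, ENNReal.toReal_ofReal (by linarith [hα.2]), smul_eq_mul,
    mul_inv_cancel_left₀ h1]

/-- Monotonicity gives measurability, and the supporting line at 1 dominates ω by an affine
function. -/
lemma integrableOn_modulus {c : ℝ} (hc : IsSupergradient (M.modulus F) 1 c) (x : ℝ) :
    IntegrableOn (fun t => M.modulus F (2 * (x - t))) (Set.Iic x) (gaussianReal 0 1) := by
  have hanti : AntitoneOn (fun t => M.modulus F (2 * (x - t))) (Set.Iic x) := by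
    intro s hs t ht hst
    have ht : t ≤ x := ht
    exact R.modulus_mono (by linarith) (by linarith)
  have hdom : Integrable (fun t => M.modulus F 1 + c * (2 * (x - t) - 1)) (gaussianReal 0 1) := by
    exact (integrable_const _).add (((((integrable_const x).sub integrable_id_gaussian).const_mul
      2).sub (integrable_const 1)).const_mul c)
  refine hdom.integrableOn.mono'
    (aemeasurable_restrict_of_antitoneOn measurableSet_Iic hanti).aestronglyMeasurable ?_
  filter_upwards [ae_restrict_mem measurableSet_Iic] with t ht
  have ht : t ≤ x := ht
  rw [Real.norm_of_nonneg (R.modulus_nonneg (by linarith))]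
  exact hc _ (by linarith)

/-- Pointwise ω(2s) ≥ min(s/q, 1) ω(2q): star-shapedness for s ≤ q, monotonicity beyond. `flciBound`
is the Gaussian integral of the factor at s = z_{1-α} - t. -/
lemma mul_modulus_le_adaptLength {α : ℝ} (hα : α ∈ Set.Ioo (0 : ℝ) 1) {c : ℝ}
    (hc : IsSupergradient (M.modulus F) 1 c) :
    flciBound α * M.modulus F (2 * z (1 - α / 2)) ≤ M.adaptLength F α := by
  have hz : Phi (z (1 - α)) = 1 - α := Phi_z (by linarith [hα.2]) (by linarith [hα.1])
  have hq := z_half_pos hα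
  set q := z (1 - α / 2) with hqdef
  set x := z (1 - α) with hx
  have hb : flciBound α = (∫ t in Set.Iic x, min (x - t) q ∂(gaussianReal 0 1)) / q := by
    rw [setIntegral_min_gaussian hq.le, hz, flciBound, ← hx, ← hqdef]
    change (x * (1 - α) - (x - q) * Phi (x - q) + gaussianPDFReal 0 1 x
      - gaussianPDFReal 0 1 (x - q)) / q = _
    ring
  rw [adaptLength_eq hα, hb, ← hx, div_mul_eq_mul_div, mul_div_assoc, ← integral_mul_const]
  refine setIntegral_mono_on ?_ (R.integrableOn_modulus hc x) measurableSet_Iic fun t ht => ?_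
  · have h1 : Integrable (fun t => x - t) (gaussianReal 0 1) :=
      (integrable_const x).sub integrable_id_gaussian
    exact ((h1.inf (integrable_const q)).mul_const _).integrableOn
  · have ht : t ≤ x := ht
    have hω := R.modulus_nonneg (δ := 2 * q) (by positivity)
    rcases le_total (x - t) q with h | h
    · rw [min_eq_left h]
      have h2 := R.mul_modulus_le (t := (x - t) / q) (δ := 2 * q)
        (div_nonneg (by linarith) hq.le) ((div_le_one hq).2 h) (by positivity)
      have h3 : (x - t) / q * (2 * q) = 2 * (x - t) := by field_simp
      rw [h3] at h2
      calc (x - t) * (M.modulus F (2 * q) / q) = (x - t) / q * M.modulus F (2 * q) := by ring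
        _ ≤ _ := h2
    · rw [min_eq_right h, mul_div_cancel₀ _ hq.ne']
      exact R.modulus_mono (by positivity) (by linarith)

lemma adaptLength_nonneg {α : ℝ} (hα : α ∈ Set.Ioo (0 : ℝ) 1) : 0 ≤ M.adaptLength F α := by
  rw [adaptLength_eq hα]
  refine setIntegral_nonneg measurableSet_Iic fun t ht => R.modulus_nonneg ?_
  have ht : t ≤ z (1 - α) := ht
  linarith

end Regular
end Design

/-! ### Two-sided tests of a normal mean -/

lemma gaussianPDFReal_le_of_sq_le {x y : ℝ} (h : y ^ 2 ≤ x ^ 2) :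
    gaussianPDFReal 0 1 x ≤ gaussianPDFReal 0 1 y := by
  simp only [gaussianPDFReal, sub_zero, NNReal.coe_one, mul_one]
  gcongr

/-- The derivative in `b` is a difference of densities at the two endpoints, nonpositive for b > 0
since the left endpoint is farther from 0; negative `b` follows by reflection. -/
lemma Phi_interval_le {c : ℝ} (hc : 0 ≤ c) (b : ℝ) :
    Phi (c - b) - Phi (-c - b) ≤ Phi c - Phi (-c) := by
  have hder : ∀ b, HasDerivAt (fun b => Phi (c - b) - Phi (-c - b))
      (-gaussianPDFReal 0 1 (c - b) + gaussianPDFReal 0 1 (-c - b)) b := by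
    intro b
    have h1 := (hasDerivAt_Phi (c - b)).comp b ((hasDerivAt_id b).const_sub c)
    have h2 := (hasDerivAt_Phi (-c - b)).comp b ((hasDerivAt_id b).const_sub (-c))
    exact (h1.sub h2).congr_deriv (by ring)
  have hanti : AntitoneOn (fun b => Phi (c - b) - Phi (-c - b)) (Set.Ici 0) := by
    refine antitoneOn_of_deriv_nonpos (convex_Ici 0)
      (fun b _ => (hder b).continuousAt.continuousWithinAt)
      (fun b _ => (hder b).differentiableAt.differentiableWithinAt) fun b hb => ?_
    rw [interior_Ici] at hb
    have hb : 0 < b := hb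
    rw [(hder b).deriv]
    have := gaussianPDFReal_le_of_sq_le (x := -c - b) (y := c - b) (by nlinarith)
    linarith
  have hpos : ∀ b, 0 ≤ b → Phi (c - b) - Phi (-c - b) ≤ Phi c - Phi (-c) := fun b hb => by
    simpa using hanti Set.self_mem_Ici hb hb
  rcases le_total 0 b with hb | hb
  · exact hpos b hb
  · have h1 := hpos (-b) (by linarith)
    have h2 := Phi_neg (c - b)
    have h3 := Phi_neg (-c - b)
    have h4 : -(c - b) = -c - -b := by ring
    have h5 : -(-c - b) = c - -b := by ring
    rw [h4] at h2
    rw [h5] at h3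
    linarith

lemma gaussianReal_le_abs {c : ℝ} (hc : 0 ≤ c) (b : ℝ) :
    gaussianReal b 1 {t | c ≤ |t|} = ENNReal.ofReal (1 - (Phi (c - b) - Phi (-c - b))) := by
  have := nullSingletonClass_gaussianReal (μ := 0) (v := 1) one_ne_zero
  have h1 : {t : ℝ | c ≤ |t|} = (Set.Ioo (-c) c)ᶜ := by
    ext t; simp [← abs_lt]
  have h2 : gaussianReal b 1 (Set.Ioo (-c) c)
      = ENNReal.ofReal (Phi (c - b) - Phi (-c - b)) := by
    rw [gaussianReal_one_eq_map, Measure.map_apply (by fun_prop) measurableSet_Ioo,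
      ← gaussianReal_Icc (by linarith), ← measure_congr Ioo_ae_eq_Icc]
    congr 1; ext t
    simp only [Set.mem_preimage, Set.mem_Ioo]
    constructor <;> rintro ⟨h1, h2⟩ <;> constructor <;> linarith
  rw [h1, prob_compl_eq_one_sub measurableSet_Ioo, h2, ENNReal.ofReal_sub 1
    (by linarith [Phi_mono (by linarith : -c - b ≤ c - b)]), ENNReal.ofReal_one]

/-- There is a two-sided test of a normal mean with null rejection probability `1 - α`. -/
lemma exists_unbiased_test {α : ℝ} (hα : α ∈ Set.Ioo (0 : ℝ) 1) :
    ∃ c : ℝ, gaussianReal 0 1 {t | c ≤ |t|} = ENNReal.ofReal (1 - α) ∧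
      ∀ b, ENNReal.ofReal (1 - α) ≤ gaussianReal b 1 {t | c ≤ |t|} := by
  have h0 : 0 < (1 + α) / 2 := by linarith [hα.1]
  have h1 : (1 + α) / 2 < 1 := by linarith [hα.2]
  set c := z ((1 + α) / 2) with hc
  have hP : Phi c = (1 + α) / 2 := Phi_z h0 h1
  have hc0 : 0 ≤ c := by
    rw [hc]
    refine le_of_lt ((lt_z_iff h0 h1).2 ?_)
    rw [Phi_zero]; linarith [hα.1]
  have h2 : Phi c - Phi (-c) = α := by rw [Phi_neg, hP]; ring
  refine ⟨c, ?_, fun b => ?_⟩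
  · rw [gaussianReal_le_abs hc0, sub_zero, sub_zero, h2]
  · rw [gaussianReal_le_abs hc0]
    refine ENNReal.ofReal_le_ofReal ?_
    linarith [Phi_interval_le hc0 b]

namespace Design
open scoped RealInnerProductSpace

variable {n p : ℕ} {M : Design n p} {F : Set (RegFun p)} {g : RegFun p}

/-! ### Minimal-norm elements of the class with a given value of the target -/

variable (M F) in
/-- `k τ` minimizes the norm among the elements of `F` whose target equals `τ`. -/
structure IsMinNorm (k : ℝ → RegFun p) : Prop where
  mem : ∀ τ, k τ ∈ F
  target : ∀ τ, M.target (k τ) = τ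
  le : ∀ h ∈ F, ‖M.obs (k (M.target h))‖ ≤ ‖M.obs h‖

lemma exists_isMinNorm (hsymm : ∀ f ∈ F, -f ∈ F) (hgF : ∀ f ∈ F, f - g ∈ F)
    (h : ∀ L₀ : ℝ, ∃ f ∈ F, M.target f = L₀ ∧
      ∀ f' ∈ F, M.target f' = L₀ → M.sqDist f g ≤ M.sqDist f' g) : ∃ k, IsMinNorm M F k := by
  choose f hf hfL hmin using h
  -- Translation by `g` recentres the projection problem at the origin.
  refine ⟨fun τ => f (τ + M.target g) - g, fun τ => hgF _ (hf _),
    fun τ => by rw [target_sub, hfL]; ring, fun h hh => ?_⟩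
  have := hmin (M.target h + M.target g) (h + g) (add_mem_class hsymm hgF hh) (target_add M h g)
  rw [sqDist_eq, sqDist_eq, map_add, add_sub_cancel_right, ← map_sub] at this
  exact (pow_le_pow_iff_left₀ (norm_nonneg _) (norm_nonneg _) two_ne_zero).1 this

namespace IsMinNorm

variable {k : ℝ → RegFun p} (K : IsMinNorm M F k)
include K

lemma convexOn_norm (hconv : Convex ℝ F) :
    ConvexOn ℝ Set.univ fun τ => ‖M.obs (k τ)‖ := by
  refine ⟨convex_univ, fun s _ t _ a b ha hb hab => ?_⟩
  have h1 := K.le _ (hconv (K.mem s) (K.mem t) ha hb hab)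
  rw [target_add, target_smul, target_smul, K.target, K.target, map_add, map_smul, map_smul] at h1
  refine h1.trans ((norm_add_le _ _).trans ?_)
  rw [norm_smul, norm_smul, Real.norm_of_nonneg ha, Real.norm_of_nonneg hb]
  rfl

lemma continuous_norm (hconv : Convex ℝ F) : Continuous fun τ => ‖M.obs (k τ)‖ := by
  rw [← continuousOn_univ]
  exact (K.convexOn_norm hconv).continuousOn isOpen_univ

/-- The midpoint of two minimizers competes at the midpoint target, so the parallelogram law bounds
their distance by a second difference of the squared minimal norm, which is continuous by convexity.
This makes the inverted confidence set jointly measurable. -/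
lemma continuous_obs (hconv : Convex ℝ F) : Continuous fun τ => M.obs (k τ) := by
  have hm := K.continuous_norm hconv
  have key : ∀ s t, ‖M.obs (k s) - M.obs (k t)‖ ^ 2
      ≤ 2 * ‖M.obs (k s)‖ ^ 2 + 2 * ‖M.obs (k t)‖ ^ 2
        - 4 * ‖M.obs (k ((1 / 2 : ℝ) * s + (1 / 2 : ℝ) * t))‖ ^ 2 := by
    intro s t
    have h1 := K.le _ (hconv (K.mem s) (K.mem t) (by norm_num : (0 : ℝ) ≤ 1 / 2)
      (by norm_num : (0 : ℝ) ≤ 1 / 2) (by norm_num))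
    rw [target_add, target_smul, target_smul, K.target, K.target, map_add, map_smul, map_smul,
      ← smul_add, norm_smul] at h1
    have h2 := parallelogram_law_with_norm ℝ (M.obs (k s)) (M.obs (k t))
    have h3 := pow_le_pow_left₀ (norm_nonneg _) h1 2
    rw [mul_pow] at h3
    norm_num at h3 ⊢
    nlinarith
  rw [continuous_iff_continuousAt]
  intro t
  rw [ContinuousAt, tendsto_iff_norm_sub_tendsto_zero]
  have hc : Continuous fun s => 2 * ‖M.obs (k s)‖ ^ 2 + 2 * ‖M.obs (k t)‖ ^ 2
        - 4 * ‖M.obs (k ((1 / 2 : ℝ) * s + (1 / 2 : ℝ) * t))‖ ^ 2 := by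
    have := hm.comp (by fun_prop : Continuous fun s : ℝ => (1 / 2 : ℝ) * s + (1 / 2 : ℝ) * t)
    exact ((continuous_const.mul (hm.pow 2)).add continuous_const).sub
      (continuous_const.mul (this.pow 2))
  have h0 := hc.tendsto t
  have h1 : (1 / 2 : ℝ) * t + (1 / 2 : ℝ) * t = t := by ring
  have h2 : 2 * ‖M.obs (k t)‖ ^ 2 + 2 * ‖M.obs (k t)‖ ^ 2 - 4 * ‖M.obs (k t)‖ ^ 2 = 0 := by ring
  rw [h1, h2] at h0
  have h3 := squeeze_zero (fun s => sq_nonneg ‖M.obs (k s) - M.obs (k t)‖) (fun s => key s t) h0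
  have h4 := (Real.continuous_sqrt.tendsto 0).comp h3
  rw [Real.sqrt_zero] at h4
  exact h4.congr fun s => Real.sqrt_sq (norm_nonneg _)

/-- The variational inequality for the nearest point of a convex set. It makes g + k τ least
favourable: every other element with the same target is covered at least as often. -/
lemma sq_norm_le_inner (hconv : Convex ℝ F) {h : RegFun p} (hh : h ∈ F) :
    ‖M.obs (k (M.target h))‖ ^ 2 ≤ ⟪M.obs (k (M.target h)), M.obs h⟫ := by
  set v := M.obs (k (M.target h)) with hv
  set w := M.obs h with hw
  have key : -2 * ⟪v, w - v⟫ ≤ 0 := by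
    refine nonpos_of_forall_le_mul (y := ‖w - v‖ ^ 2) fun t ht => ?_
    have h1 := K.le _ (hconv (K.mem (M.target h)) hh (sub_nonneg.2 ht.2.le) ht.1.le
      (sub_add_cancel 1 t))
    rw [target_add, target_smul, target_smul, K.target, ← add_mul, sub_add_cancel, one_mul,
      map_add, map_smul, map_smul, ← hv, ← hw] at h1
    have h2 : (1 - t) • v + t • w = v + t • (w - v) := by
      rw [sub_smul, smul_sub, one_smul]; abel
    have h3 := pow_le_pow_left₀ (norm_nonneg _) h1 2
    rw [h2, norm_add_sq_real, inner_smul_right, norm_smul, mul_pow, Real.norm_eq_abs, sq_abs] at h3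
    have h4 : t * (-2 * ⟪v, w - v⟫) ≤ t * (t * ‖w - v‖ ^ 2) := by linarith
    exact le_of_mul_le_mul_left h4 ht.1
  rw [inner_sub_right, real_inner_self_eq_norm_sq] at key
  linarith

/-- The sublevel set lies between the open and the closed interval of half-length ω(2s)/2: values
|τ| strictly below it are reached by shrinking a near-optimal element. -/
lemma volume_norm_le (R : Regular M F) {s : ℝ} (hs : 0 ≤ s) :
    volume {τ | ‖M.obs (k τ)‖ ≤ s} = ENNReal.ofReal (M.modulus F (2 * s)) := by
  set ρ := M.modulus F (2 * s) / 2 with hρ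
  have h1 : {τ | ‖M.obs (k τ)‖ ≤ s} ⊆ Set.Icc (-ρ) ρ := by
    intro τ hτ
    have hτ : ‖M.obs (k τ)‖ ≤ s := hτ
    have h2 := R.le_modulus (K.mem τ) (δ := 2 * s) (by linarith)
    have h3 := R.le_modulus (R.symm _ (K.mem τ)) (δ := 2 * s) (by
      rw [map_neg, norm_neg]; linarith)
    rw [target_neg, K.target] at h3
    rw [K.target] at h2
    constructor <;> linarith
  have h2 : Set.Ioo (-ρ) ρ ⊆ {τ | ‖M.obs (k τ)‖ ≤ s} := by
    intro τ hτ
    obtain ⟨h, hh, hn, hL⟩ := R.exists_gt_of_lt_modulus (B := 2 * |τ|) (δ := 2 * s)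
      (by linarith) (by have := abs_lt.2 hτ; linarith)
    have hL0 : 0 < M.target h := by linarith [abs_nonneg τ]
    set t := |τ| / M.target h with ht
    have ht0 : 0 ≤ t := by positivity
    have ht1 : t ≤ 1 := (div_le_one hL0).2 (by linarith)
    have hth := smul_mem_class R.conv R.zero hh ht0 ht1
    have htL : M.target (t • h) = |τ| := by rw [target_smul, ht, div_mul_cancel₀ _ hL0.ne']
    have htn : ‖M.obs (t • h)‖ ≤ s := by
      rw [map_smul, norm_smul, Real.norm_of_nonneg ht0]
      nlinarith [norm_nonneg (M.obs h)]
    rcases abs_cases τ with ⟨h5, _⟩ | ⟨h5, _⟩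
    · have := K.le _ hth
      rw [htL, h5] at this
      exact this.trans htn
    · have := K.le _ (R.symm _ hth)
      rw [target_neg, htL, h5, neg_neg, map_neg, norm_neg] at this
      exact this.trans htn
  have h3 : ρ - -ρ = M.modulus F (2 * s) := by rw [hρ]; ring
  refine le_antisymm ?_ ?_
  · refine (measure_mono h1).trans_eq ?_
    rw [Real.volume_Icc, h3]
  · refine le_trans (le_of_eq ?_) (measure_mono h2)
    rw [Real.volume_Ioo, h3]

/-! ### The smallest expected length of a confidence set -/

/-- Both sides are the product measure of the region t ≤ x - ‖k τ‖, sliced in the two orders. -/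
lemma lintegral_Phi_eq (R : Regular M F) {c x : ℝ}
    (hc : IsSupergradient (M.modulus F) 1 c) :
    ∫⁻ τ, ENNReal.ofReal (Phi (x - ‖M.obs (k τ)‖))
      = ENNReal.ofReal (∫ t in Set.Iic x, M.modulus F (2 * (x - t)) ∂(gaussianReal 0 1)) := by
  have hm : Measurable fun τ => ‖M.obs (k τ)‖ := (K.continuous_norm R.conv).measurable
  set S : Set (ℝ × ℝ) := {q | q.2 ≤ x - ‖M.obs (k q.1)‖} with hS
  have hSm : MeasurableSet S :=
    measurableSet_le measurable_snd (measurable_const.sub (hm.comp measurable_fst))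
  have h1 : ∫⁻ τ, ENNReal.ofReal (Phi (x - ‖M.obs (k τ)‖))
      = (volume.prod (gaussianReal 0 1)) S := by
    rw [Measure.prod_apply hSm]
    refine lintegral_congr fun τ => ?_
    rw [ofReal_Phi]; rfl
  rw [h1, Measure.prod_apply_symm hSm,
    ofReal_integral_eq_lintegral_ofReal (R.integrableOn_modulus hc x),
    ← lintegral_indicator measurableSet_Iic]
  · refine lintegral_congr fun t => ?_
    have h2 : (fun τ => (τ, t)) ⁻¹' S = {τ | ‖M.obs (k τ)‖ ≤ x - t} := by
      ext τ
      simp only [hS, Set.mem_preimage, Set.mem_ofPred_eq]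
      constructor <;> intro h <;> linarith
    rw [h2]
    by_cases ht : t ≤ x
    · rw [K.volume_norm_le R (by linarith), Set.indicator_of_mem (Set.mem_Iic.2 ht)]
    · rw [Set.indicator_of_notMem (by simpa using ht)]
      convert measure_empty (μ := volume)
      ext τ
      simp only [Set.mem_ofPred_eq, Set.mem_empty_iff_false, iff_false, not_le]
      linarith [norm_nonneg (M.obs (k τ)), not_le.1 ht]
  · filter_upwards [ae_restrict_mem measurableSet_Iic] with t ht
    have ht : t ≤ x := ht
    exact R.modulus_nonneg (by linarith)

omit K in
-- Fubini, then translation invariance of Lebesgue measure to centre the targets at L g.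
lemma expLength_eq_lintegral {C : (Fin n → ℝ) → Set ℝ}
    (hC : MeasurableSet {q : (Fin n → ℝ) × ℝ | q.2 ∈ C q.1}) (g : RegFun p) :
    M.expLength g C = ∫⁻ τ, M.law g {y | τ + M.target g ∈ C y} := by
  rw [lintegral_add_right_eq_self (fun θ => M.law g {y | θ ∈ C y}) (M.target g)]
  have h1 := Measure.prod_apply (μ := M.law g) (ν := volume) hC
  have h2 := Measure.prod_apply_symm (μ := M.law g) (ν := volume) hC
  exact h1.symm.trans h2

lemma lintegral_Phi_le_expLength (hsymm : ∀ f ∈ F, -f ∈ F)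
    (hgF : ∀ f ∈ F, f - g ∈ F) {α : ℝ} (hα : α ∈ Set.Ioo (0 : ℝ) 1)
    {C : (Fin n → ℝ) → Set ℝ} (hC : M.IsConfSet F α C) :
    ∫⁻ τ, ENNReal.ofReal (Phi (z (1 - α) - ‖M.obs (k τ)‖)) ≤ M.expLength g C := by
  rw [expLength_eq_lintegral hC.1]
  refine lintegral_mono fun τ => ?_
  have hf := add_mem_class hsymm hgF (K.mem τ)
  have h1 := hC.2.trans (iInf₂_le _ hf)
  rw [target_add, K.target] at h1
  have h2 := M.law_ge_of_law_ge hα _ g (measurable_prodMk_right (y := τ + M.target g) hC.1) h1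
  rwa [map_add, sub_add_cancel_right, norm_neg] at h2

/-- The confidence set that inverts, for each value of the target, the most powerful test against
`g`. -/
lemma exists_isConfSet_expLength_eq (R : Regular M F)
    (hgF : ∀ f ∈ F, f - g ∈ F) {α : ℝ} (hα : α ∈ Set.Ioo (0 : ℝ) 1) :
    ∃ C, M.IsConfSet F α C ∧
      M.expLength g C = ∫⁻ τ, ENNReal.ofReal (Phi (z (1 - α) - ‖M.obs (k τ)‖)) := by
  have hz : Phi (z (1 - α)) = 1 - α := Phi_z (by linarith [hα.2]) (by linarith [hα.1])
  -- The weights sum to one, so there is at least one observation.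
  obtain ⟨i⟩ : Nonempty (Fin n) := by
    by_contra h
    rw [not_nonempty_iff] at h
    have := M.sum_w
    rw [Finset.univ_eq_empty, Finset.sum_empty] at this
    exact zero_ne_one this
  set e : EuclideanSpace ℝ (Fin n) := EuclideanSpace.single i 1 with he
  have he1 : ‖e‖ = 1 := by simp [he]
  obtain ⟨c, hc0, hc⟩ := exists_unbiased_test hα
  set v : ℝ → EuclideanSpace ℝ (Fin n) := fun τ => M.obs (k τ) with hv
  -- Acceptance region of the most powerful test of g + k τ against `g`: reject when the data lie
  -- far in the direction of `g`.
  set A : ℝ → Set (Fin n → ℝ) := fun τ =>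
    {y | ⟪-v τ, M.scale y - (M.obs g + v τ)⟫ ≤ z (1 - α) * ‖v τ‖} with hA
  -- When `v τ = 0` the null and the alternative have the same law and the region `A τ` degenerates.
  -- A two-sided event in one coordinate has probability exactly 1 - α under `g` and at least that
  -- under every other mean.
  set B : Set (Fin n → ℝ) := {y | c ≤ |⟪e, M.scale y - M.obs g⟫|} with hB
  have hBlaw : ∀ f, M.law f B = gaussianReal ⟪e, M.obs f - M.obs g⟫ 1 {t | c ≤ |t|} := by
    intro f
    have h1 : (1 : ℝ≥0) = (‖e‖ ^ 2).toNNReal := by rw [he1]; simp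
    rw [h1, ← law_map_inner_sub, Measure.map_apply (M.measurable_inner_scale _ _)
      (measurableSet_le measurable_const measurable_abs)]
    rfl
  set C : (Fin n → ℝ) → Set ℝ := fun y =>
    {θ | (v (θ - M.target g) ≠ 0 ∧ y ∈ A (θ - M.target g)) ∨ (v (θ - M.target g) = 0 ∧ y ∈ B)}
    with hCdef
  have hC1 : ∀ τ, v τ ≠ 0 → {y | τ + M.target g ∈ C y} = A τ := by
    intro τ h; ext y; simp [hCdef, h]
  have hC0 : ∀ τ, v τ = 0 → {y | τ + M.target g ∈ C y} = B := by
    intro τ h; ext y; simp [hCdef, h]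
  have hCm : MeasurableSet {q : (Fin n → ℝ) × ℝ | q.2 ∈ C q.1} := by
    have hvm : Measurable fun q : (Fin n → ℝ) × ℝ => v (q.2 - M.target g) :=
      (K.continuous_obs R.conv).measurable.comp (measurable_snd.sub_const _)
    have hsm : Measurable fun q : (Fin n → ℝ) × ℝ => M.scale q.1 :=
      M.measurable_scale.comp measurable_fst
    have h0 : MeasurableSet {q : (Fin n → ℝ) × ℝ | v (q.2 - M.target g) = 0} :=
      hvm (measurableSet_singleton 0)
    refine (h0.compl.inter (measurableSet_le ?_ ?_)).union
      (h0.inter (measurableSet_le measurable_const ?_))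
    · exact Measurable.inner (𝕜 := ℝ) hvm.neg (hsm.sub (measurable_const.add hvm))
    · exact measurable_const.mul hvm.norm
    · exact (Measurable.inner (𝕜 := ℝ) measurable_const (hsm.sub measurable_const)).norm
  refine ⟨C, ⟨hCm, le_iInf₂ fun f hf => ?_⟩, ?_⟩
  · have hh := hgF f hf
    have hτ : M.target f = M.target (f - g) + M.target g := by rw [target_sub]; ring
    set τ := M.target (f - g) with hτdef
    rw [hτ]
    by_cases h0 : v τ = 0
    · rw [hC0 τ h0, hBlaw]; exact hc _
    · have hpos : 0 < ‖-v τ‖ := by rw [norm_neg]; exact norm_pos_iff.2 h0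
      rw [hC1 τ h0, hA, law_inner_le _ (neg_ne_zero.2 h0)]
      refine ENNReal.ofReal_le_ofReal ?_
      nth_rw 1 [← hz]
      refine Phi_mono ((le_div_iff₀ hpos).2 ?_)
      have h1 := K.sq_norm_le_inner R.conv hh
      rw [← hτdef] at h1
      have h2 : M.obs f - (M.obs g + v τ) = M.obs (f - g) - v τ := by rw [map_sub]; abel
      rw [h2, inner_neg_left, inner_sub_right, real_inner_self_eq_norm_sq, norm_neg]
      have h3 : ‖v τ‖ ^ 2 ≤ ⟪v τ, M.obs (f - g)⟫ := h1
      linarith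
  · rw [expLength_eq_lintegral hCm]
    refine lintegral_congr fun τ => ?_
    by_cases h0 : v τ = 0
    · have h1 : M.obs (k τ) = 0 := h0
      rw [hC0 τ h0, hBlaw, sub_self, inner_zero_right, hc0, h1, norm_zero, sub_zero, hz]
    · have hpos : 0 < ‖v τ‖ := norm_pos_iff.2 h0
      rw [hC1 τ h0, hA, law_inner_le _ (neg_ne_zero.2 h0)]
      have h1 : M.obs g - (M.obs g + v τ) = -v τ := by abel
      rw [h1, real_inner_self_eq_norm_sq, norm_neg]
      congr 2
      change _ = z (1 - α) - ‖v τ‖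
      field_simp

lemma bestExpLength_eq (R : Regular M F) (hgF : ∀ f ∈ F, f - g ∈ F) {α : ℝ}
    (hα : α ∈ Set.Ioo (0 : ℝ) 1) {c : ℝ} (hc : IsSupergradient (M.modulus F) 1 c) :
    M.bestExpLength F α g = ENNReal.ofReal (M.adaptLength F α) := by
  rw [Regular.adaptLength_eq hα, ← K.lintegral_Phi_eq R hc]
  obtain ⟨C, hC, hCe⟩ := K.exists_isConfSet_expLength_eq R hgF hα
  refine le_antisymm ((iInf₂_le C hC).trans_eq hCe) (le_iInf₂ fun C hC => ?_)
  exact K.lintegral_Phi_le_expLength R.symm hgF hα hC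

end IsMinNorm
end Design

/-! ### Numerical bounds for the normal distribution -/

/-- The Taylor polynomial of `exp (-u)`. -/
noncomputable def expNegPoly (m : ℕ) (u : ℝ) : ℝ :=
  ∑ k ∈ Finset.range m, (-1) ^ k * u ^ k / (k.factorial : ℝ)

lemma hasDerivAt_expNegPoly (m : ℕ) (u : ℝ) :
    HasDerivAt (expNegPoly (m + 1)) (-expNegPoly m u) u := by
  have h : expNegPoly (m + 1)
      = fun u => (∑ k ∈ Finset.range m, (-1) ^ (k + 1) * u ^ (k + 1) / ((k + 1).factorial : ℝ)) + 1 := by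
    ext u; simp [expNegPoly, Finset.sum_range_succ']
  rw [h]
  refine HasDerivAt.add_const 1 ?_
  rw [expNegPoly, ← Finset.sum_neg_distrib]
  refine HasDerivAt.fun_sum fun k _ => ?_
  have h1 := (((hasDerivAt_pow (k + 1) u).const_mul ((-1 : ℝ) ^ (k + 1))).div_const
    ((k + 1).factorial : ℝ))
  refine h1.congr_deriv ?_
  have h2 : (k.factorial : ℝ) ≠ 0 := by exact_mod_cast k.factorial_ne_zero
  rw [Nat.factorial_succ]
  push_cast
  have h3 : (k : ℝ) + 1 ≠ 0 := by positivity
  field_simp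
  ring

lemma expNegPoly_zero_right (m : ℕ) : expNegPoly (m + 1) 0 = 1 := by
  simp [expNegPoly, Finset.sum_range_succ']

lemma nonneg_of_hasDerivAt_nonneg {f f' : ℝ → ℝ} (hf : ∀ x, HasDerivAt f (f' x) x)
    (hf' : ∀ x, 0 ≤ x → 0 ≤ f' x) (h0 : f 0 = 0) {x : ℝ} (hx : 0 ≤ x) : 0 ≤ f x := by
  have hmono : MonotoneOn f (Set.Ici 0) := by
    refine monotoneOn_of_deriv_nonneg (convex_Ici 0)
      (fun b _ => (hf b).continuousAt.continuousWithinAt)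
      (fun b _ => (hf b).differentiableAt.differentiableWithinAt) fun b hb => ?_
    rw [interior_Ici] at hb
    rw [(hf b).deriv]
    exact hf' b (le_of_lt hb)
  rw [← h0]
  exact hmono Set.self_mem_Ici hx hx

/-- The signed remainder vanishes at 0 and its derivative is the previous signed remainder, so
nonnegativity propagates by induction. -/
lemma exp_neg_alternating (m : ℕ) {u : ℝ} (hu : 0 ≤ u) :
    0 ≤ (-1) ^ m * (Real.exp (-u) - expNegPoly m u) := by
  induction m generalizing u with
  | zero => simp [expNegPoly, Real.exp_nonneg]
  | succ m ih =>
    refine nonneg_of_hasDerivAt_nonneg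
      (f := fun u => (-1) ^ (m + 1) * (Real.exp (-u) - expNegPoly (m + 1) u))
      (f' := fun u => (-1) ^ m * (Real.exp (-u) - expNegPoly m u)) (fun x => ?_)
      (fun x hx => ih hx) (by simp [expNegPoly_zero_right]) hu
    have h1 : HasDerivAt (fun u : ℝ => Real.exp (-u)) (-Real.exp (-x)) x := by
      simpa using (hasDerivAt_neg x).exp
    refine ((h1.sub (hasDerivAt_expNegPoly m x)).const_mul _).congr_deriv ?_
    rw [pow_succ]; ring

/-- The antiderivative of the Taylor polynomial of `exp (-t ^ 2 / 2)`. -/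
noncomputable def erfPoly (m : ℕ) (y : ℝ) : ℝ :=
  ∑ k ∈ Finset.range m, (-1) ^ k * y ^ (2 * k + 1) / (2 ^ k * (k.factorial : ℝ) * (2 * k + 1))

lemma hasDerivAt_erfPoly (m : ℕ) (y : ℝ) :
    HasDerivAt (erfPoly m) (expNegPoly m (y ^ 2 / 2)) y := by
  refine HasDerivAt.fun_sum fun k _ => ?_
  have h1 := (((hasDerivAt_pow (2 * k + 1) y).const_mul ((-1 : ℝ) ^ k)).div_const
    (2 ^ k * (k.factorial : ℝ) * (2 * k + 1)))
  refine h1.congr_deriv ?_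
  have h2 : (k.factorial : ℝ) ≠ 0 := by exact_mod_cast k.factorial_ne_zero
  have h3 : 2 * (k : ℝ) + 1 ≠ 0 := by positivity
  push_cast
  simp only [div_pow, ← pow_mul]
  field_simp

lemma gaussianPDFReal_mul_sqrt (y : ℝ) :
    Real.sqrt (2 * Real.pi) * gaussianPDFReal 0 1 y = Real.exp (-(y ^ 2 / 2)) := by
  have h : Real.sqrt (2 * Real.pi) ≠ 0 := by positivity
  simp only [gaussianPDFReal, sub_zero, NNReal.coe_one, mul_one]
  rw [mul_inv_cancel_left₀ h, neg_div]

lemma Phi_alternating (m : ℕ) {y : ℝ} (hy : 0 ≤ y) :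
    0 ≤ (-1) ^ m * (Real.sqrt (2 * Real.pi) * (Phi y - 1 / 2) - erfPoly m y) := by
  refine nonneg_of_hasDerivAt_nonneg
    (f := fun y => (-1) ^ m * (Real.sqrt (2 * Real.pi) * (Phi y - 1 / 2) - erfPoly m y))
    (f' := fun y => (-1) ^ m * (Real.exp (-(y ^ 2 / 2)) - expNegPoly m (y ^ 2 / 2)))
    (fun x => ?_) (fun x _ => exp_neg_alternating m (by positivity))
    (by simp [Phi_zero, erfPoly]) hy
  have h1 := (((hasDerivAt_Phi x).sub_const (1 / 2)).const_mul (Real.sqrt (2 * Real.pi)))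
  rw [gaussianPDFReal_mul_sqrt] at h1
  exact (h1.sub (hasDerivAt_erfPoly m x)).const_mul _

lemma sqrt_two_pi_bounds :
    2.506628 ≤ Real.sqrt (2 * Real.pi) ∧ Real.sqrt (2 * Real.pi) ≤ 2.50663 := by
  constructor
  · refine Real.le_sqrt_of_sq_le ?_
    have := Real.pi_gt_d6
    norm_num at this ⊢
    linarith
  · refine Real.sqrt_le_iff.2 ⟨by norm_num, ?_⟩
    have := Real.pi_lt_d6
    norm_num at this ⊢
    linarith

lemma Phi_ge {y s : ℝ} (hy : 0 ≤ y) (hs : 0 ≤ s) (h : s * 2.50663 ≤ erfPoly 14 y) :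
    1 / 2 + s ≤ Phi y := by
  -- An even number of terms gives a lower bound and an odd number an upper bound.
  have h1 := Phi_alternating 14 hy
  have h2 := sqrt_two_pi_bounds
  rw [Even.neg_one_pow (by decide), one_mul] at h1
  nlinarith [mul_nonneg hs (sub_nonneg.2 h2.2)]

lemma Phi_le {y s : ℝ} (hy : 0 ≤ y) (hs : 0 ≤ s) (h : erfPoly 15 y ≤ s * 2.506628) :
    Phi y ≤ 1 / 2 + s := by
  have h1 := Phi_alternating 15 hy
  have h2 := sqrt_two_pi_bounds
  rw [Odd.neg_one_pow (by decide)] at h1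
  nlinarith [mul_nonneg hs (sub_nonneg.2 h2.1)]

lemma gaussianPDFReal_ge {y s : ℝ} (hs : 0 ≤ s) (h : s * 2.50663 ≤ expNegPoly 14 (y ^ 2 / 2)) :
    s ≤ gaussianPDFReal 0 1 y := by
  have h1 := exp_neg_alternating 14 (by positivity : 0 ≤ y ^ 2 / 2)
  have h2 := sqrt_two_pi_bounds
  rw [← gaussianPDFReal_mul_sqrt] at h1
  rw [Even.neg_one_pow (by decide), one_mul] at h1
  nlinarith [mul_nonneg hs (sub_nonneg.2 h2.2)]

lemma gaussianPDFReal_le {y s : ℝ} (hs : 0 ≤ s) (h : expNegPoly 15 (y ^ 2 / 2) ≤ s * 2.506628) :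
    gaussianPDFReal 0 1 y ≤ s := by
  have h1 := exp_neg_alternating 15 (by positivity : 0 ≤ y ^ 2 / 2)
  have h2 := sqrt_two_pi_bounds
  rw [← gaussianPDFReal_mul_sqrt] at h1
  rw [Odd.neg_one_pow (by decide)] at h1
  nlinarith [mul_nonneg hs (sub_nonneg.2 h2.1)]

/-- The truncated first moment `E (y - Z)⁺` of a standard normal `Z`. -/
noncomputable def truncMoment (y : ℝ) : ℝ := y * Phi y + gaussianPDFReal 0 1 y

lemma monotone_truncMoment : Monotone truncMoment := by
  have h : ∀ y, HasDerivAt truncMoment (Phi y) y := fun y =>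
    (((hasDerivAt_id y).mul (hasDerivAt_Phi y)).add (hasDerivAt_gaussianPDFReal y)).congr_deriv
      (by simp)
  exact monotone_of_deriv_nonneg (fun y => (h y).differentiableAt)
    fun y => by rw [(h y).deriv]; exact Phi_nonneg y

lemma truncMoment_neg (y : ℝ) : truncMoment (-y) = truncMoment y - y := by
  rw [truncMoment, truncMoment, Phi_neg, gaussianPDFReal_even]; ring

/-- Since `truncMoment` is monotone, interval bounds on the quantiles transfer directly to the
numerator. -/
lemma flciBound_eq {α : ℝ} (hα : α ∈ Set.Ioo (0 : ℝ) 1) :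
    flciBound α = (truncMoment (z (1 - α)) - truncMoment (z (1 - α) - z (1 - α / 2)))
      / z (1 - α / 2) := by
  have hz : Phi (z (1 - α)) = 1 - α := Phi_z (by linarith [hα.2]) (by linarith [hα.1])
  rw [truncMoment, hz, flciBound]
  simp only [truncMoment, Phi]
  ring

lemma z_bounds_95 : 1.6448 ≤ z 0.95 ∧ z 0.95 ≤ 1.645 := by
  constructor
  · refine le_of_lt ((lt_z_iff (by norm_num) (by norm_num)).2 ?_)
    refine (Phi_le (s := 0.449998) (by norm_num) (by norm_num) ?_).trans_lt (by norm_num)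
    norm_num [erfPoly, Finset.sum_range_succ, Nat.factorial]
  · refine (z_le_iff (by norm_num) (by norm_num)).2 ?_
    refine le_trans (by norm_num) (Phi_ge (s := 0.45) (by norm_num) (by norm_num) ?_)
    norm_num [erfPoly, Finset.sum_range_succ, Nat.factorial]

lemma z_bounds_975 : 1.9599 ≤ z 0.975 ∧ z 0.975 ≤ 1.96 := by
  constructor
  · refine le_of_lt ((lt_z_iff (by norm_num) (by norm_num)).2 ?_)
    refine (Phi_le (s := 0.474999) (by norm_num) (by norm_num) ?_).trans_lt (by norm_num)
    norm_num [erfPoly, Finset.sum_range_succ, Nat.factorial]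
  · refine (z_le_iff (by norm_num) (by norm_num)).2 ?_
    refine le_trans (by norm_num) (Phi_ge (s := 0.475) (by norm_num) (by norm_num) ?_)
    norm_num [erfPoly, Finset.sum_range_succ, Nat.factorial]

lemma truncMoment_ge_of {y s t : ℝ} (hy : 0 ≤ y) (hs : 0 ≤ s) (ht : 0 ≤ t)
    (h1 : s * 2.50663 ≤ erfPoly 14 y) (h2 : t * 2.50663 ≤ expNegPoly 14 (y ^ 2 / 2)) :
    y * (1 / 2 + s) + t ≤ truncMoment y :=
  add_le_add (mul_le_mul_of_nonneg_left (Phi_ge hy hs h1) hy) (gaussianPDFReal_ge ht h2)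

lemma truncMoment_le_of {y s t : ℝ} (hy : 0 ≤ y) (hs : 0 ≤ s) (ht : 0 ≤ t)
    (h1 : erfPoly 15 y ≤ s * 2.506628) (h2 : expNegPoly 15 (y ^ 2 / 2) ≤ t * 2.506628) :
    truncMoment y ≤ y * (1 / 2 + s) + t :=
  add_le_add (mul_le_mul_of_nonneg_left (Phi_le hy hs h1) hy) (gaussianPDFReal_le ht h2)

theorem flciBound_five_percent : |flciBound 0.05 - 0.717| < 0.0005 := by
  have e1 : (1 - 0.05 : ℝ) = 0.95 := by norm_num
  have e2 : (1 - 0.05 / 2 : ℝ) = 0.975 := by norm_num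
  rw [flciBound_eq ⟨by norm_num, by norm_num⟩, e1, e2]
  obtain ⟨hx0, hx1⟩ := z_bounds_95
  obtain ⟨hq0, hq1⟩ := z_bounds_975
  have hq : 0 < z 0.975 := by linarith
  have h1 := monotone_truncMoment hx1
  have h2 := monotone_truncMoment hx0
  have h3 := monotone_truncMoment (by linarith : (-0.3152 : ℝ) ≤ z 0.95 - z 0.975)
  have h4 := monotone_truncMoment (by linarith : z 0.95 - z 0.975 ≤ (-0.3149 : ℝ))
  -- The series bounds require nonnegative arguments, so the negative difference of quantiles is
  -- reflected.
  rw [truncMoment_neg] at h3 h4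
  have b1 : truncMoment 1.645 ≤ 1.66591 := by
    refine (truncMoment_le_of (s := 0.45002) (t := 0.10312) (by norm_num) (by norm_num)
      (by norm_num) ?_ ?_).trans (by norm_num) <;>
    norm_num [erfPoly, expNegPoly, Finset.sum_range_succ, Nat.factorial]
  have b2 : 1.66568 ≤ truncMoment 1.6448 := by
    refine le_trans (by norm_num) (truncMoment_ge_of (s := 0.44999) (t := 0.10314) (by norm_num)
      (by norm_num) (by norm_num) ?_ ?_) <;>
    norm_num [erfPoly, expNegPoly, Finset.sum_range_succ, Nat.factorial]
  have b3 : 0.57618 ≤ truncMoment 0.3152 := by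
    refine le_trans (by norm_num) (truncMoment_ge_of (s := 0.12369) (t := 0.3796) (by norm_num)
      (by norm_num) (by norm_num) ?_ ?_) <;>
    norm_num [erfPoly, expNegPoly, Finset.sum_range_succ, Nat.factorial]
  have b4 : truncMoment 0.3149 ≤ 0.57603 := by
    refine (truncMoment_le_of (s := 0.12359) (t := 0.37966) (by norm_num) (by norm_num)
      (by norm_num) ?_ ?_).trans (by norm_num) <;>
    norm_num [erfPoly, expNegPoly, Finset.sum_range_succ, Nat.factorial]
  rw [abs_lt]
  constructor
  · rw [lt_sub_iff_add_lt, lt_div_iff₀ hq]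
    linarith
  · rw [sub_lt_iff_lt_add, div_lt_iff₀ hq]
    linarith

namespace Design

/-! ### Efficiency of fixed-length confidence intervals -/

variable {n p : ℕ} {M : Design n p} {F : Set (RegFun p)} {g : RegFun p}

lemma iInf_eq_of_isMinOn {f : ℝ → ℝ} {x : ℝ} (hx : 0 < x) (h : IsMinOn f (Set.Ioi 0) x) :
    ⨅ δ : Set.Ioi (0 : ℝ), f δ = f x := by
  have hle : ∀ δ : Set.Ioi (0 : ℝ), f x ≤ f δ := fun δ => isMinOn_iff.1 h δ δ.2
  have : Nonempty (Set.Ioi (0 : ℝ)) := ⟨⟨x, hx⟩⟩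
  have hb : BddBelow (Set.range fun δ : Set.Ioi (0 : ℝ) => f δ) :=
    ⟨f x, Set.forall_mem_range.2 hle⟩
  exact le_antisymm (ciInf_le hb ⟨x, hx⟩) (le_ciInf hle)

lemma Regular.expLength_flci (R : Regular M F) (hL : ∀ L₀ : ℝ, ∃ f ∈ F, M.target f = L₀)
    {α : ℝ} (hα : α ∈ Set.Ioo (0 : ℝ) 1) {ω' : ℝ → ℝ} {δ : ℝ} (hδ : 0 < δ)
    (hc : IsSupergradient (M.modulus F) δ (ω' δ)) {fs : RegFun p}
    (hfs : M.AttainsModulus F δ (-fs) fs) (g : RegFun p) :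
    (M.expLength g (M.flci F α δ (ω' δ) (-fs) fs)).toReal = M.flciLength F α ω' δ := by
  have hs := R.supergradient_pos hL hδ.le hc
  obtain ⟨hω, -⟩ := modulus_eq_of_attains hfs
  -- The distance constraint binds: with slack, ω would take the value ω(δ) at a smaller argument,
  -- contradicting the positive supergradient.
  have hn : 2 * ‖M.obs fs‖ = δ := by
    have h1 := hfs.2.2.1
    rw [sqDist_neg_self] at h1
    have h2 : 2 * ‖M.obs fs‖ ≤ δ := (pow_le_pow_iff_left₀ (by positivity) hδ.le two_ne_zero).1 h1
    refine le_antisymm h2 ?_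
    have h3 := hc (2 * ‖M.obs fs‖) (by positivity)
    have h4 := R.le_modulus hfs.2.1 le_rfl
    by_contra! hlt
    nlinarith
  have hsd : M.sd (M.optWeights δ (ω' δ) (-fs) fs) = ω' δ := by
    rw [sd_optWeights, R.norm_stdWeights hδ hc hn]
  have hb := R.supergradient_mul_le hc
  have hbias : max |M.maxBias F (M.optEst δ (ω' δ) (-fs) fs)|
      |M.minBias F (M.optEst δ (ω' δ) (-fs) fs)| / ω' δ
        = M.modulus F δ / (2 * ω' δ) - δ / 2 := by
    rw [R.maxBias_optEst hδ hc hfs.2.1 hn hω, R.minBias_optEst hδ hc hfs.2.1 hn hω, abs_neg,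
      max_self, abs_of_nonneg (by linarith)]
    field_simp
  have hcv := (Phi_cv hα (M.modulus F δ / (2 * ω' δ) - δ / 2)).1
  have hvol : ∀ y, volume (M.flci F α δ (ω' δ) (-fs) fs y)
      = ENNReal.ofReal (M.flciLength F α ω' δ) := by
    intro y
    simp only [flci, hsd, hbias, Real.volume_Icc, flciLength]
    congr 1; ring
  simp only [expLength, hvol]
  rw [lintegral_const, measure_univ, mul_one, ENNReal.toReal_ofReal]
  rw [flciLength]; positivity

end Design
end CATE

/-! ### Assembly of the one-sided, two-sided and numerical statements -/

theorem mainTheorem8 {n p : ℕ} (M : CATE.Design n p) (F : Set (CATE.RegFun p))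
    (hconv : Convex ℝ F) (hsymm : ∀ f ∈ F, -f ∈ F)
    (g : CATE.RegFun p) (hg : g ∈ F) (hgF : ∀ f ∈ F, f - g ∈ F)
    (α : ℝ) (hα : α ∈ Set.Ioo (0 : ℝ) 1) :
    -- (i) one-sided confidence intervals
    ((∃ f ∈ F, M.target f ≠ 0) →
      ∀ β ∈ Set.Ioo (0 : ℝ) 1, ∀ δ : ℝ, δ = CATE.z β + CATE.z (1 - α) → 0 < δ →
      ∀ fs : CATE.RegFun p, M.AttainsModulus F δ (-fs) fs → M.sqDist (-fs) fs = δ ^ 2 →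
      ∀ c : ℝ, CATE.IsSupergradient (M.modulus F) δ c →
        M.bestExcessQuantile F α β {g} / M.excessQuantile β (M.optLower F α δ c (-fs) fs) {g}
            = M.modulus F (2 * δ) / (M.modulus F δ + δ * c) ∧
        1 / 2 ≤ M.modulus F (2 * δ) / (M.modulus F δ + δ * c)) ∧
    -- (ii) fixed-length confidence intervals
    ((∀ L₀ : ℝ, ∃ f ∈ F, M.target f = L₀ ∧
        ∀ f' ∈ F, M.target f' = L₀ → M.sqDist f g ≤ M.sqDist f' g) →
      (∀ δ : ℝ, 0 < δ → BddAbove (M.modulusValues F δ)) →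
      ∀ ω' : ℝ → ℝ, (∀ δ : ℝ, 0 < δ → CATE.IsSupergradient (M.modulus F) δ (ω' δ)) →
        M.bestExpLength F α g ≠ ⊤ ∧
        (M.bestExpLength F α g).toReal / (⨅ δ : Set.Ioi (0 : ℝ), M.flciLength F α ω' δ)
          = M.adaptLength F α / (⨅ δ : Set.Ioi (0 : ℝ), M.flciLength F α ω' δ) ∧
        CATE.flciBound α
          ≤ (M.bestExpLength F α g).toReal / (⨅ δ : Set.Ioi (0 : ℝ), M.flciLength F α ω' δ) ∧
        ∀ δχ : ℝ, 0 < δχ → IsMinOn (M.flciLength F α ω') (Set.Ioi 0) δχ →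
          (M.bestExpLength F α g).toReal / (⨅ δ : Set.Ioi (0 : ℝ), M.flciLength F α ω' δ)
            = M.adaptLength F α / M.flciLength F α ω' δχ ∧
          CATE.flciBound α ≤ M.adaptLength F α / M.flciLength F α ω' δχ ∧
          ∀ fs : CATE.RegFun p, M.AttainsModulus F δχ (-fs) fs →
            (M.bestExpLength F α g).toReal
                / (M.expLength g (M.flci F α δχ (ω' δχ) (-fs) fs)).toReal
              = M.adaptLength F α / M.flciLength F α ω' δχ) ∧
    -- the universal lower bound in (ii) evaluates to 71.7% at the 95% level
    |CATE.flciBound 0.05 - 0.717| < 0.0005 := by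
  obtain h0 := CATE.Design.zero_mem_class hg hgF
  refine ⟨fun hL β hβ δ hδe hδ fs hfs hn c hc =>
    CATE.Design.one_sided_efficiency hconv hsymm hg hgF hα hL hβ hδe hδ hfs hn hc, ?_,
    CATE.flciBound_five_percent⟩
  intro hmin hbdd ω' hω'
  obtain ⟨k, K⟩ := CATE.Design.exists_isMinNorm hsymm hgF hmin
  have R : CATE.Design.Regular M F := ⟨hconv, hsymm, h0, fun δ hδ =>
    CATE.Design.bddAbove_modulusValues hconv hsymm h0 one_pos (hbdd 1 one_pos) hδ⟩
  have hL : ∀ L₀ : ℝ, ∃ f ∈ F, M.target f = L₀ := fun L₀ => ⟨k L₀, K.mem L₀, K.target L₀⟩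
  have hc := hω' 1 one_pos
  have hA0 := R.adaptLength_nonneg hα
  have hbest := K.bestExpLength_eq R hgF hα hc
  have hreal : (M.bestExpLength F α g).toReal = M.adaptLength F α := by
    rw [hbest, ENNReal.toReal_ofReal hA0]
  obtain ⟨hI0, hI1⟩ := R.iInf_flciLength_pos hα hL hω'
  have hbound : CATE.flciBound α
      ≤ M.adaptLength F α / (⨅ δ : Set.Ioi (0 : ℝ), M.flciLength F α ω' δ) := by
    rw [le_div_iff₀ hI0]
    -- Multiplying the upper bound on the infimum by `flciBound α` needs it nonnegative; otherwise
    -- the claim is trivial because the numerator is nonnegative.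
    rcases le_total 0 (CATE.flciBound α) with h | h
    · exact (mul_le_mul_of_nonneg_left hI1 h).trans (R.mul_modulus_le_adaptLength hα hc)
    · exact (mul_nonpos_of_nonpos_of_nonneg h hI0.le).trans hA0
  refine ⟨by rw [hbest]; exact ENNReal.ofReal_ne_top, by rw [hreal], by rw [hreal]; exact hbound,
    fun δχ hδχ hmχ => ?_⟩
  have hI := CATE.Design.iInf_eq_of_isMinOn hδχ hmχ
  rw [hI] at hbound
  refine ⟨by rw [hreal, hI], hbound, fun fs hfs => ?_⟩
  rw [hreal, R.expLength_flci hL hα hδχ (hω' δχ hδχ) hfs]
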